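/- Let $R$ be a field, let $G$ be a finite group and let $\mathcal P$ be a finite $G$-poset, i.e. a finite partially ordered set on which $G$ acts by order-preserving maps. The transporter category $\mathcal P\rtimes G$ has the elements of $\mathcal P$ as objects; a morphism $x\to y$ is an element $g\in G$ with ${}^gx\le y$, and composition is multiplication in $G$. Let $\pi:\mathcal P\rtimes G\to G$ be the projection onto $G$, regarded as a category with one object. For a finite category $\mathcal C$, finitely generated right modules over the category algebra $R\mathcal C$ are identified with contravariant functors from $\mathcal C$ to finite-dimensional $R$-vector spaces; $\underline R$ is the constant functor with value $R$ (for $\mathcal C=G$, the trivial module $R$). For $A=RG$ or $A=R\,\mathcal P\rtimes G$, let $G_0(A)$ be the Grothendieck group of the abelian category of finitely generated right $A$-modules, and let $G_0^{st}(A)$ be the stable Grothendieck group, the quotient of $G_0(A)$ by the subgroup generated by the classes of finitely generated projective modules (the cokernel of the Cartan map). For a right $R\,\mathcal P\rtimes G$-module $\mathfrak F$, let $\mathsf C_*(\mathcal P;\mathfrak F)$ be the complex of right $RG$-modules $$\mathsf C_i(\mathcal P;\mathfrak F)=\bigoplus_{x_0<\cdots<x_i}\mathfrak F(x_i),$$ $$\partial(f_{x_0<\cdots<x_i})=\sum_{t=0}^{i-1}(-1)^t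 f_{x_0<\cdots<\widehat{x_t}<\cdots<x_i}+(-1)^i\bigl[\mathfrak F(x_{i-1}\to x_i)(f)\bigr]_{x_0<\cdots<x_{i-1}},$$ on which $g\in G$ acts by sending $f$ in the summand of $x_0<\cdots<x_i$ to $\mathfrak F(g:{}^{g^{-1}}x_i\to x_i)(f)$ in the summand of ${}^{g^{-1}}x_0<\cdots<{}^{g^{-1}}x_i$, and let $\mathrm H_i(\mathcal P;\mathfrak F)$ be its homology. Restriction along $\pi$ sends a right $RG$-module $M$ to the constant presheaf $\kappa_M=M\circ\pi$. There are homomorphisms $$r_\pi:G_0(RG)\to G_0(R\,\mathcal P\rtimes G),\qquad [M]\mapsto[\kappa_M],$$ $$lk_\pi:G_0(R\,\mathcal P\rtimes G)\to G_0(RG),\qquad [\mathfrak F]\mapsto\sum_i(-1)^i[\mathrm H_i(\mathcal P;\mathfrak F)],$$ and they induce homomorphisms $r'_\pi:G_0^{st}(RG)\to G_0^{st}(R\,\mathcal P\rtimes G)$ and $lk'_\pi:G_0^{st}(R\,\mathcal P\rtimes G)\to G_0^{st}(RG)$. Let $\mathrm{St}_{\mathcal P}(G)=\sum_i(-1)^i[\mathrm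 H_i(\mathcal P;\underline R)]-[R]\in G_0(RG)$. 1. If $\mathcal P$ is connected (in particular non-empty) and has vanishing homology, that is, $\mathrm H_i(\mathcal P;\underline R)=0$ for all $i>0$, then $r_\pi$ and $r'_\pi$ are injective, and $lk_\pi$ and $lk'_\pi$ are surjective. 2. If $\mathrm{St}_{\mathcal P}(G)$ is virtual projective, that is, $\mathrm{St}_{\mathcal P}(G)=[Q]-[Q']$ in $G_0(RG)$ for some finitely generated projective $RG$-modules $Q$ and $Q'$, then $r'_\pi$ is injective and $lk'_\pi$ is surjective. -/

import Mathlib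

open CategoryTheory Opposite CategoryTheory.Limits ZeroObject

set_option linter.unusedSectionVars false

universe u

namespace GPoset

/-- The objects of the transporter category `P ⋊ G` of a `G`-poset `P`: the elements of `P`. -/
structure TransporterCat (G P : Type u) : Type u where
  pt : P

namespace TransporterCat

variable {G P : Type u} [Group G] [PartialOrder P] [MulAction G P]
  [CovariantClass G P HSMul.hSMul LE.le]

/-- The transporter category `P ⋊ G`. A morphism `x ⟶ y` is a formal product `α g` of some `g : G`
and a morphism `α : g • x ⟶ y` of the poset `P`, i.e. an element `g` with `g • x ≤ y`. The composite
of `β h : x ⟶ y` followed by `α g : y ⟶ z` is `(α (g • β)) (g h)`. -/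
instance : Category.{u} (TransporterCat G P) where
  Hom x y := {g : G // g • x.pt ≤ y.pt}
  id x := ⟨1, (one_smul G x.pt).le⟩
  comp {x y z} β α := ⟨α.1 * β.1, by
    rw [mul_smul]
    exact (smul_mono_right α.1 β.2).trans α.2⟩
  id_comp _ := Subtype.ext (mul_one _)
  comp_id _ := Subtype.ext (one_mul _)
  assoc _ _ _ := Subtype.ext (mul_assoc _ _ _).symm

@[ext]
theorem hom_ext {x y : TransporterCat G P} {α β : x ⟶ y} (h : α.1 = β.1) : α = β :=
  Subtype.ext h

@[simp] theorem id_val (x : TransporterCat G P) : (𝟙 x : x ⟶ x).1 = 1 := rfl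
@[simp] theorem comp_val {x y z : TransporterCat G P} (β : x ⟶ y) (α : y ⟶ z) :
    (β ≫ α).1 = α.1 * β.1 := rfl

variable (G P) in
/-- The projection functor `π : P ⋊ G ⥤ G`, where `G` is regarded as a category with one object.
In `SingleObj G` the composite of `h` followed by `g` is `g * h`. -/
def π : TransporterCat G P ⥤ SingleObj G where
  obj _ := SingleObj.star G
  map α := α.1
  map_id _ := rfl
  map_comp _ _ := rfl

end TransporterCat


/-- The category of finitely generated right modules over the category algebra `R C` of a finite
category `C`, in the form of contravariant functors from `C` to finite-dimensional `R`-vector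
spaces. For `C = SingleObj G` these are the finitely generated right `RG`-modules, with
`m · g = M(g)(m)`; for `C = P ⋊ G` they are the `G`-presheaves on `P`. -/
abbrev RightMod (R : Type u) [Field R] (C : Type*) [Category.{u} C] := Cᵒᵖ ⥤ FGModuleCat.{u} R

namespace RightMod

variable {R : Type u} [Field R] {C : Type*} [Category.{u} C]

/-- The linear map `F(y) → F(x)` given by a morphism `x ⟶ y`. -/
def act (F : RightMod R C) {x y : C} (α : x ⟶ y) : F.obj (op y) →ₗ[R] F.obj (op x) :=
  (F.map α.op).hom.hom

@[simp] theorem act_id (F : RightMod R C) (x : C) (v : F.obj (op x)) : F.act (𝟙 x) v = v := by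
  simp [act]

theorem act_comp (F : RightMod R C) {x y z : C} (β : x ⟶ y) (α : y ⟶ z) (v : F.obj (op z)) :
    F.act (β ≫ α) v = F.act β (F.act α v) := by
  simp [act]

/-- The component of a morphism of presheaves at an object. -/
def app {F F' : RightMod R C} (η : F ⟶ F') (x : C) : F.obj (op x) →ₗ[R] F'.obj (op x) :=
  (η.app (op x)).hom.hom

theorem app_act {F F' : RightMod R C} (η : F ⟶ F') {x y : C} (α : x ⟶ y) (v : F.obj (op y)) :
    app η x (F.act α v) = F'.act α (app η y v) :=
  congr($(η.naturality α.op).hom.hom v)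

/-- Constructor for presheaves from unbundled data. -/
def mk (V : C → Type u) [∀ x, AddCommGroup (V x)] [∀ x, Module R (V x)]
    [∀ x, Module.Finite R (V x)]
    (a : ∀ {x y : C}, (x ⟶ y) → (V y →ₗ[R] V x))
    (a_id : ∀ (x : C) (v : V x), a (𝟙 x) v = v)
    (a_comp : ∀ {x y z : C} (β : x ⟶ y) (α : y ⟶ z) (v : V z), a (β ≫ α) v = a β (a α v)) :
    RightMod R C where
  obj x := FGModuleCat.of R (V x.unop)
  map α := FGModuleCat.ofHom (a α.unop)
  map_id x := by
    ext v
    exact a_id x.unop v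
  map_comp α β := by
    ext v
    exact a_comp β.unop α.unop v

/-- Constructor for morphisms of presheaves. -/
def homMk {F F' : RightMod R C} (η : ∀ x, F.obj (op x) →ₗ[R] F'.obj (op x))
    (h : ∀ {x y : C} (α : x ⟶ y) (v : F.obj (op y)), η x (F.act α v) = F'.act α (η y v)) :
    F ⟶ F' where
  app x := ObjectProperty.homMk (ModuleCat.ofHom (η x.unop))
  naturality x y α := by
    ext v
    exact h α.unop v

theorem hom_ext {F F' : RightMod R C} {η θ : F ⟶ F'} (h : ∀ x v, app η x v = app θ x v) : η = θ := by
  ext x v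
  exact h x.unop v

@[simp] theorem app_homMk {F F' : RightMod R C} (η : ∀ x, F.obj (op x) →ₗ[R] F'.obj (op x))
    (h : ∀ {x y : C} (α : x ⟶ y) (v : F.obj (op y)), η x (F.act α v) = F'.act α (η y v)) (x : C) :
    app (homMk η h) x = η x := rfl

@[simp] theorem app_id (F : RightMod R C) (x : C) (v) : app (𝟙 F) x v = v := rfl
@[simp] theorem app_comp {F F' F'' : RightMod R C} (η : F ⟶ F') (θ : F' ⟶ F'') (x : C) (v) :
   app (η ≫ θ) x v = app θ x (app η x v) := rfl
@[simp] theorem app_zero (F F' : RightMod R C) (x : C) (v) : app (0 : F ⟶ F') x v = 0 := rfl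


theorem epi_iff {F F' : RightMod R C} (η : F ⟶ F') :
    Epi η ↔ ∀ x, Function.Surjective (app η x) := by
  rw [NatTrans.epi_iff_epi_app]
  refine ⟨fun h x => ?_, fun h x => ?_⟩
  · have := h (op x)
    have h2 : Epi ((forget₂ (FGModuleCat R) (ModuleCat R)).map (η.app (op x))) := inferInstance
    exact (ModuleCat.epi_iff_surjective _).1 h2
  · apply (forget₂ (FGModuleCat R) (ModuleCat R)).epi_of_epi_map
    exact (ModuleCat.epi_iff_surjective _).2 (h x.unop)

theorem mono_iff {F F' : RightMod R C} (η : F ⟶ F') :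
    Mono η ↔ ∀ x, Function.Injective (app η x) := by
  rw [NatTrans.mono_iff_mono_app]
  refine ⟨fun h x => ?_, fun h x => ?_⟩
  · have := h (op x)
    have h2 : Mono ((forget₂ (FGModuleCat R) (ModuleCat R)).map (η.app (op x))) := inferInstance
    exact (ModuleCat.mono_iff_injective _).1 h2
  · apply (forget₂ (FGModuleCat R) (ModuleCat R)).mono_of_mono_map
    exact (ModuleCat.mono_iff_injective _).2 (h x.unop)

theorem exact_iff (S : ShortComplex (RightMod R C)) :
    S.Exact ↔ ∀ x, Function.Exact (app S.f x) (app S.g x) := by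
  have key : S.Exact ↔ ∀ x : Cᵒᵖ, (S.map ((evaluation _ _).obj x)).Exact := by
    constructor
    · intro h x
      exact h.map _
    · intro h
      rw [ShortComplex.exact_iff_isZero_homology, Functor.isZero_iff]
      intro x
      exact ((S.map ((evaluation _ _).obj x)).exact_iff_isZero_homology.1 (h x)).of_iso
        (S.mapHomologyIso ((evaluation _ _).obj x)).symm
  rw [key]
  have key2 : ∀ x : Cᵒᵖ, (S.map ((evaluation _ _).obj x)).Exact ↔
      Function.Exact (app S.f x.unop) (app S.g x.unop) := by
    intro x
    rw [← ShortComplex.exact_map_iff_of_faithful _ (forget₂ (FGModuleCat R) (ModuleCat R))]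
    exact ShortComplex.ShortExact.moduleCat_exact_iff_function_exact _
  simp only [key2]
  exact ⟨fun h x => h (op x), fun h x => h x.unop⟩

theorem shortExact_iff (S : ShortComplex (RightMod R C)) :
    S.ShortExact ↔ ∀ x, Function.Injective (app S.f x) ∧ Function.Exact (app S.f x) (app S.g x) ∧
      Function.Surjective (app S.g x) := by
  constructor
  · intro h x
    exact ⟨(mono_iff _).1 h.mono_f x, (exact_iff _).1 h.exact x, (epi_iff _).1 h.epi_g x⟩
  · intro h
    exact ShortComplex.ShortExact.mk' ((exact_iff _).2 fun x => (h x).2.1)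
      ((mono_iff _).2 fun x => (h x).1) ((epi_iff _).2 fun x => (h x).2.2)

end RightMod

/-- The relations of the Grothendieck group: `[X₂] = [X₁] + [X₃]` for every short exact sequence
`0 → X₁ → X₂ → X₃ → 0`. -/
def G0.relations (A : Type*) [Category* A] [Abelian A] : AddSubgroup (FreeAbelianGroup A) :=
  AddSubgroup.closure {x | ∃ S : ShortComplex A, S.ShortExact ∧
    x = FreeAbelianGroup.of S.X₂ - FreeAbelianGroup.of S.X₁ - FreeAbelianGroup.of S.X₃}

/-- The Grothendieck group of an abelian category: the free abelian group on the objects modulo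
`[X₂] = [X₁] + [X₃]` for every short exact sequence `0 → X₁ → X₂ → X₃ → 0`. -/
abbrev G0 (A : Type*) [Category* A] [Abelian A] : Type _ := FreeAbelianGroup A ⧸ G0.relations A

namespace G0

variable {A : Type*} [Category* A] [Abelian A]

/-- The class `[X]` of an object. -/
def mk (X : A) : G0 A := QuotientAddGroup.mk (FreeAbelianGroup.of X)

theorem mk_shortExact {S : ShortComplex A} (hS : S.ShortExact) : mk S.X₂ = mk S.X₁ + mk S.X₃ := by
  have h : FreeAbelianGroup.of S.X₂ - FreeAbelianGroup.of S.X₁ - FreeAbelianGroup.of S.X₃ ∈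
      relations A := AddSubgroup.subset_closure ⟨S, hS, rfl⟩
  have h2 := (QuotientAddGroup.eq_zero_iff _).2 h
  rw [QuotientAddGroup.mk_sub, QuotientAddGroup.mk_sub, sub_sub, sub_eq_zero] at h2
  exact h2

/-- The universal property: a function on objects that is additive on short exact sequences
induces a homomorphism. -/
def lift {B : Type*} [AddCommGroup B] (f : A → B)
    (hf : ∀ S : ShortComplex A, S.ShortExact → f S.X₂ = f S.X₁ + f S.X₃) : G0 A →+ B :=
  QuotientAddGroup.lift (relations A) (FreeAbelianGroup.lift f) (by
    rw [relations, AddSubgroup.closure_le]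
    rintro _ ⟨S, hS, rfl⟩
    simp [AddMonoidHom.mem_ker, hf S hS])

@[simp] theorem lift_mk {B : Type*} [AddCommGroup B] (f : A → B)
    (hf : ∀ S : ShortComplex A, S.ShortExact → f S.X₂ = f S.X₁ + f S.X₃) (X : A) :
    lift f hf (mk X) = f X :=
  (QuotientAddGroup.lift_mk' _ _ _).trans (FreeAbelianGroup.lift_apply_of f X)

theorem mk_isZero {X : A} (hX : IsZero X) : mk X = 0 := by
  have h := mk_shortExact (S := ShortComplex.mk (0 : X ⟶ X) (0 : X ⟶ X) (by simp))
    (.mk' (ShortComplex.exact_of_isZero_X₂ _ hX) ⟨fun _ _ _ => hX.eq_of_tgt _ _⟩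
      ⟨fun _ _ _ => hX.eq_of_src _ _⟩)
  simpa using h

theorem mk_iso {X Y : A} (e : X ≅ Y) : mk X = mk Y := by
  have h := mk_shortExact (S := ShortComplex.mk (0 : (0 : A) ⟶ X) e.hom (by simp))
    (.mk' ((ShortComplex.exact_iff_mono _ rfl).2 inferInstance) inferInstance inferInstance)
  simpa [mk_isZero (isZero_zero A)] using h

theorem mk_of_exact {X Y : A} (f : X ⟶ Y) {k : KernelFork f} (hk : IsLimit k)
    {c : CokernelCofork f} (hc : IsColimit c) : mk X - mk k.pt = mk Y - mk c.pt := by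
  have h1 := mk_shortExact (S := ShortComplex.mk (kernel.ι f) (Abelian.factorThruImage f)
    (by rw [← cancel_mono (Abelian.image.ι f)]; simp)) (.mk' (by
      apply ShortComplex.exact_of_f_is_kernel
      apply isKernelOfComp (Abelian.image.ι f) f (kernelIsKernel f) 
      · simp) inferInstance inferInstance)
  have h2 := mk_shortExact (S := ShortComplex.mk (Abelian.image.ι f) (cokernel.π f)
    (by simp)) (.mk' (by
      apply ShortComplex.exact_of_f_is_kernel
      exact kernelIsKernel _) inferInstance inferInstance)
  have h3 : mk (kernel f) = mk k.pt := mk_iso ((kernelIsKernel f).conePointUniqueUpToIso hk)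
  have h4 : mk (cokernel f) = mk c.pt := mk_iso ((cokernelIsCokernel f).coconePointUniqueUpToIso hc)
  simp only at h1 h2
  rw [h1, h2, h3, h4]
  abel

theorem sum_homology (K : ChainComplex A ℕ) (N : ℕ) (hK : IsZero (K.X N)) :
    ∑ i ∈ Finset.range N, (-1 : ℤ) ^ i • mk (K.homology i) =
      ∑ i ∈ Finset.range N, (-1 : ℤ) ^ i • mk (K.X i) := by
  have key : ∀ i, mk (K.X (i + 1)) - mk (K.cycles (i + 1)) = mk (K.cycles i) - mk (K.homology i) := by
    intro i
    have h1 : (ComplexShape.down ℕ).prev i = i + 1 := by simp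
    have h2 : (ComplexShape.down ℕ).next (i + 1) = i := by simp
    refine mk_of_exact (K.toCycles (i + 1) i) (k := KernelFork.ofι (K.iCycles (i + 1)) ?_) ?_
      (K.homologyIsCokernel (i + 1) i h1)
    · rw [← cancel_mono (K.iCycles i)]; simp
    · exact isKernelOfComp (K.iCycles i) (K.d (i + 1) i) (K.cyclesIsKernel (i + 1) i h2) _ (by simp)
  have h0 : mk (K.cycles 0) = mk (K.X 0) := by
    have : IsIso (K.iCycles 0) := K.isIso_iCycles 0 _ rfl (by simp)
    exact mk_iso (asIso (K.iCycles 0))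
  have gen : ∀ n, ∑ i ∈ Finset.range n, (-1 : ℤ) ^ i • mk (K.homology i) =
      ∑ i ∈ Finset.range n, (-1 : ℤ) ^ i • mk (K.X i) + (-1 : ℤ) ^ n • (mk (K.X n) - mk (K.cycles n)) := by
    intro n
    induction n with
    | zero => simp [h0]
    | succ n ih =>
      rw [Finset.sum_range_succ, Finset.sum_range_succ, ih, key n, pow_succ]
      simp only [smul_sub, mul_neg, mul_one, neg_smul]
      abel
  have hc : IsZero (K.cycles N) := by
    rw [IsZero.iff_id_eq_zero, ← cancel_mono (K.iCycles N)]
    exact hK.eq_of_tgt _ _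
  rw [gen N, mk_isZero hK, mk_isZero hc]
  simp

variable (A) in
/-- The subgroup generated by the classes of projective objects: the image of the Cartan map
`G₀(D^b(proj-A)) → G₀(A)`. -/
def projClasses : AddSubgroup (G0 A) :=
  AddSubgroup.closure {x | ∃ Q : A, Projective Q ∧ x = mk Q}

/-- A virtual projective element of the Grothendieck group: a difference of two classes of
projective objects. -/
def IsVirtualProjective (x : G0 A) : Prop :=
  ∃ Q Q' : A, Projective Q ∧ Projective Q' ∧ x = mk Q - mk Q'

end G0

/-- The stable Grothendieck group: the cokernel of the Cartan map. It is the Grothendieck group of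
the Verdier quotient of `D^b(mod-A)` by `D^b(proj-A)`, which is equivalent, for a Gorenstein algebra,
to the stable category of maximal Cohen-Macaulay modules. -/
abbrev StG0 (A : Type*) [Category* A] [Abelian A] : Type _ := G0 A ⧸ G0.projClasses A

/-- The nondegenerate `n`-chains `x₀ < x₁ < ⋯ < xₙ` of a poset. -/
@[ext]
structure Chain (P : Type u) [PartialOrder P] (n : ℕ) : Type u where
  pts : Fin (n + 1) → P
  strictMono : StrictMono pts

namespace Chain

variable {P : Type u} [PartialOrder P]

instance [Finite P] (n : ℕ) : Finite (Chain P n) :=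
  Finite.of_injective (fun σ : Chain P n => σ.pts) fun _ _ h => Chain.ext h

noncomputable instance [Finite P] (n : ℕ) : Fintype (Chain P n) := Fintype.ofFinite _

/-- The largest element `xₙ` of a chain. -/
def last {n : ℕ} (σ : Chain P n) : P := σ.pts (Fin.last n)

/-- The face of a chain obtained by omitting `x_t`. -/
def face {n : ℕ} (t : Fin (n + 2)) (σ : Chain P (n + 1)) : Chain P n where
  pts := σ.pts ∘ t.succAbove
  strictMono := σ.strictMono.comp (Fin.strictMono_succAbove t)

theorem last_face_le {n : ℕ} (t : Fin (n + 2)) (σ : Chain P (n + 1)) :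
    (face t σ).last ≤ σ.last :=
  σ.strictMono.monotone (Fin.le_last _)

theorem face_face {n : ℕ} (t : Fin (n + 3)) (s : Fin (n + 2)) (σ : Chain P (n + 2)) :
    face (s.predAbove t) (face (t.succAbove s) σ) = face s (face t σ) := by
  ext k
  exact congrArg σ.pts (Fin.succAbove_succAbove_succAbove_predAbove t s k)

theorem isEmpty [Finite P] {n : ℕ} (hn : Nat.card P ≤ n) : IsEmpty (Chain P n) :=
  ⟨fun σ => by
    have h := Nat.card_le_card_of_injective σ.pts σ.strictMono.injective
    simp at h
    omega⟩

variable {G : Type u} [Group G] [MulAction G P] [CovariantClass G P HSMul.hSMul LE.le]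

instance (n : ℕ) : SMul G (Chain P n) where
  smul g σ :=
    { pts := fun i => g • σ.pts i
      strictMono := ((smul_mono_right g).strictMono_of_injective
        (MulAction.injective g)).comp σ.strictMono }

instance (n : ℕ) : MulAction G (Chain P n) where
  one_smul σ := Chain.ext (funext fun i => one_smul G (σ.pts i))
  mul_smul g h σ := Chain.ext (funext fun i => mul_smul g h (σ.pts i))

end Chain

namespace TransporterCat
variable {G P : Type u} [Group G] [PartialOrder P] [MulAction G P]
  [CovariantClass G P HSMul.hSMul LE.le]

variable (G) in
/-- The morphism `p ⟶ q` of `P ⋊ G` coming from `p ≤ q` in `P`, i.e. the image of `p ≤ q` under the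
embedding `P ⥤ P ⋊ G`. -/
def incl {p q : P} (h : p ≤ q) : (⟨p⟩ : TransporterCat G P) ⟶ ⟨q⟩ := ⟨1, by simpa using h⟩

/-- The morphism `1 g : xₙ ⟶ g • xₙ` of `P ⋊ G`, for the last element `xₙ` of a chain. -/
def conj {n : ℕ} (g : G) (σ : Chain P n) :
    (⟨σ.last⟩ : TransporterCat G P) ⟶ ⟨(g • σ).last⟩ := ⟨g, le_rfl⟩

end TransporterCat

namespace RightMod

variable {R : Type u} [Field R] {G P : Type u} [Group G] [PartialOrder P]
  [MulAction G P] [CovariantClass G P HSMul.hSMul LE.le] [Finite P]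

theorem act_eval (F : RightMod R (TransporterCat G P)) {n : ℕ}
    (f : ∀ σ : Chain P n, F.obj (op ⟨σ.last⟩)) {p : P} {σ τ : Chain P n} (h : σ = τ)
    (α : (⟨p⟩ : TransporterCat G P) ⟶ ⟨σ.last⟩) (β : (⟨p⟩ : TransporterCat G P) ⟶ ⟨τ.last⟩)
    (hαβ : α.1 = β.1) : F.act α (f σ) = F.act β (f τ) := by
  subst h
  rw [TransporterCat.hom_ext hαβ]

/-- The right `RG`-module `C_n(P; F) = ⨁_{x₀ < ⋯ < xₙ} F(xₙ)`; the finite direct sum is realised as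
the module of families `f = (f_σ)_σ` indexed by the chains. An element `g` sends the summand of the
chain `σ` to that of `g⁻¹ • σ` through `F(1 g : g⁻¹ • xₙ ⟶ xₙ)`, that is,
`(f · g)_σ = F(1 g : xₙ ⟶ g • xₙ)(f_{g • σ})`. -/
def chains (F : RightMod R (TransporterCat G P)) (n : ℕ) : RightMod R (SingleObj G) :=
  mk (fun _ => ∀ σ : Chain P n, F.obj (op ⟨σ.last⟩))
    (fun {_ _} (g : G) => LinearMap.pi fun σ : Chain P n =>
      F.act (TransporterCat.conj g σ) ∘ₗ LinearMap.proj (g • σ))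
    (fun _ f => funext fun σ => by
      refine (act_eval F f (one_smul G σ) _ (𝟙 _) rfl).trans (F.act_id _ _))
    (fun {_ _ _} (h g : G) f => funext fun σ => by
      refine (act_eval F f (mul_smul g h σ) _
        (TransporterCat.conj h σ ≫ TransporterCat.conj g (h • σ)) rfl).trans ?_
      exact F.act_comp _ _ _)

/-- The inclusion of the summand of the chain `τ` into the direct sum. -/
noncomputable def single (F : RightMod R (TransporterCat G P)) {n : ℕ} (τ : Chain P n) :
    F.obj (op ⟨τ.last⟩) →ₗ[R] ∀ σ : Chain P n, F.obj (op ⟨σ.last⟩) :=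
  open Classical in LinearMap.single R (fun σ : Chain P n => F.obj (op ⟨σ.last⟩)) τ

/-- The differential `C_{n+1}(P; F) → C_n(P; F)`: an element `v` of the summand of
`σ = (x₀ < ⋯ < x_{n+1})` goes to the sum over `t` of `(-1)^t` times the image of `v` in the summand of
`σ` without `x_t`. That image is `v` itself for `t ≤ n`, the last element being the same (the map below
is then `F` of an identity), and `F(xₙ ⟶ x_{n+1})(v)` for `t = n + 1`. -/
noncomputable def boundary (F : RightMod R (TransporterCat G P)) (n : ℕ) :
    (∀ σ : Chain P (n + 1), F.obj (op ⟨σ.last⟩)) →ₗ[R] ∀ σ : Chain P n, F.obj (op ⟨σ.last⟩) :=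
  ∑ σ : Chain P (n + 1), ∑ t : Fin (n + 2), (-1 : R) ^ (t : ℕ) •
    (F.single (σ.face t) ∘ₗ F.act (TransporterCat.incl G (σ.last_face_le t)) ∘ₗ LinearMap.proj σ)

theorem sum_single (F : RightMod R (TransporterCat G P)) {n : ℕ}
    (f : ∀ σ : Chain P n, F.obj (op ⟨σ.last⟩)) : ∑ σ, F.single σ (f σ) = f := by
  classical
  simp only [single]
  funext τ
  simp [Finset.sum_apply, LinearMap.single_apply]

theorem boundary_single (F : RightMod R (TransporterCat G P)) (n : ℕ) (σ : Chain P (n + 1))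
    (v : F.obj (op ⟨σ.last⟩)) : F.boundary n (F.single σ v) =
      ∑ t : Fin (n + 2), (-1 : R) ^ (t : ℕ) •
        F.single (σ.face t) (F.act (TransporterCat.incl G (σ.last_face_le t)) v) := by
  classical
  simp only [boundary, LinearMap.sum_apply]
  rw [Finset.sum_eq_single σ]
  · simp [single]
  · intro τ _ hτ
    simp [single, hτ]
  · simp

theorem single_congr (F : RightMod R (TransporterCat G P)) {n : ℕ} {q : P} (v : F.obj (op ⟨q⟩))
    {σ τ : Chain P n} (h : σ = τ) (hσ : σ.last ≤ q) (hτ : τ.last ≤ q) :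
    F.single σ (F.act (TransporterCat.incl G hσ) v) =
      F.single τ (F.act (TransporterCat.incl G hτ) v) := by
  subst h; rfl

theorem incl_incl {p q r : P} (h : p ≤ q) (h' : q ≤ r) :
    TransporterCat.incl G h ≫ TransporterCat.incl G h' = TransporterCat.incl G (h.trans h') :=
  TransporterCat.hom_ext (one_mul 1)

theorem boundary_boundary (F : RightMod R (TransporterCat G P)) (n : ℕ)
    (f : ∀ σ : Chain P (n + 2), F.obj (op ⟨σ.last⟩)) :
    F.boundary n (F.boundary (n + 1) f) = 0 := by
  rw [← F.sum_single f]
  simp only [map_sum, boundary_single, map_smul, Finset.smul_sum, smul_smul, ← act_comp, incl_incl]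
  refine Finset.sum_eq_zero fun σ _ => ?_
  rw [← Fintype.sum_prod_type' (f := fun (t : Fin (n + 3)) (s : Fin (n + 2)) =>
    ((-1 : R) ^ (t : ℕ) * (-1) ^ (s : ℕ)) • F.single ((σ.face t).face s)
      (F.act (TransporterCat.incl G (((σ.face t).last_face_le s).trans (σ.last_face_le t))) (f σ)))]
  refine Finset.sum_involution (fun ts _ => (ts.1.succAbove ts.2, ts.2.predAbove ts.1)) ?_ ?_ ?_ ?_
  · rintro ⟨t, s⟩ -
    have h := F.single_congr (f σ) (σ.face_face t s)
      (((σ.face _).last_face_le _).trans (σ.last_face_le _))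
      (((σ.face _).last_face_le _).trans (σ.last_face_le _))
    simp only [h]
    rw [← add_smul, ← pow_add, ← pow_add, Fin.neg_one_pow_succAbove_add_predAbove]
    simp
  · rintro ⟨t, s⟩ - - h
    exact Fin.succAbove_ne t s (congrArg Prod.fst h)
  · simp
  · rintro ⟨t, s⟩ -
    exact Prod.ext (Fin.succAbove_succAbove_predAbove t s) (Fin.predAbove_predAbove_succAbove t s)

theorem single_act (F : RightMod R (TransporterCat G P)) {n : ℕ} (g : G) (σ τ : Chain P n)
    (w : F.obj (op ⟨(g • σ).last⟩)) :
    F.act (TransporterCat.conj g τ) (F.single (g • σ) w (g • τ)) =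
      F.single σ (F.act (TransporterCat.conj g σ) w) τ := by
  classical
  by_cases h : τ = σ
  · subst h
    rw [single, single, LinearMap.single_apply, LinearMap.single_apply, Pi.single_eq_same,
      Pi.single_eq_same]
  · have h' : g • τ ≠ g • σ := fun h' => h (MulAction.injective g h')
    rw [single, single, LinearMap.single_apply, LinearMap.single_apply,
      Pi.single_eq_of_ne h, Pi.single_eq_of_ne h', map_zero]

theorem act_conj_incl (F : RightMod R (TransporterCat G P)) {n : ℕ} (g : G) (t : Fin (n + 2))
    (σ : Chain P (n + 1)) (w : F.obj (op ⟨(g • σ).last⟩))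
    (h : (g • σ.face t).last ≤ (g • σ).last) :
    F.act (TransporterCat.conj g (σ.face t)) (F.act (TransporterCat.incl G h) w) =
      F.act (TransporterCat.incl G (σ.last_face_le t)) (F.act (TransporterCat.conj g σ) w) := by
  rw [← act_comp, ← act_comp]
  congr 2
  exact TransporterCat.hom_ext ((one_mul g).trans (mul_one g).symm)

theorem boundary_act (F : RightMod R (TransporterCat G P)) (n : ℕ) (g : G)
    (f : ∀ σ : Chain P (n + 1), F.obj (op ⟨σ.last⟩)) :
    F.boundary n (fun σ => F.act (TransporterCat.conj g σ) (f (g • σ))) =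
      fun τ => F.act (TransporterCat.conj g τ) (F.boundary n f (g • τ)) := by
  funext τ
  simp only [boundary, LinearMap.sum_apply, Finset.sum_apply]
  rw [map_sum]
  refine Fintype.sum_equiv (MulAction.toPerm g : Equiv.Perm (Chain P (n + 1))) _ _ fun σ => ?_
  rw [map_sum]
  refine Finset.sum_congr rfl fun t _ => ?_
  simp only [LinearMap.smul_apply, Pi.smul_apply, LinearMap.comp_apply,
    LinearMap.proj_apply]
  rw [map_smul]
  congr 1
  refine Eq.trans ?_ (F.single_act g (σ.face t) τ _).symm
  exact congrArg (fun v => F.single (σ.face t) v τ)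
    (F.act_conj_incl g t σ (f (g • σ)) ((g • σ).last_face_le t)).symm

/-- The complex `C_*(P; F)` of right `RG`-modules. -/
noncomputable def chainComplex (F : RightMod R (TransporterCat G P)) :
    ChainComplex (RightMod R (SingleObj G)) ℕ :=
  ChainComplex.of F.chains
    (fun n => homMk (fun _ => F.boundary n) fun {_ _} g f => F.boundary_act n g f)
    fun n => hom_ext fun _ f => F.boundary_boundary n f

end RightMod

namespace RightMod

variable {R : Type u} [Field R] {G P : Type u} [Group G] [PartialOrder P]
  [MulAction G P] [CovariantClass G P HSMul.hSMul LE.le]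

section
variable [Finite P]

/-- The right `RG`-module `H_i(P; F)`: the homology of the `G`-poset `P` with coefficients in the
`G`-presheaf `F`. -/
noncomputable def homology (F : RightMod R (TransporterCat G P)) (i : ℕ) :
    RightMod R (SingleObj G) :=
  F.chainComplex.homology i

/-- The homology representation `∑ i, (-1)^i [H_i(P; F)]` in `G₀(RG)`. As `P` has no chain of more than
`|P|` elements, the complex is zero in degrees `≥ |P|`, so that all other terms are zero. -/
noncomputable def homologyClass (F : RightMod R (TransporterCat G P)) :
    G0 (RightMod R (SingleObj G)) :=
  ∑ i ∈ Finset.range (Nat.card P), (-1 : ℤ) ^ i • G0.mk (F.homology i)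

theorem isZero_iff {C : Type*} [Category.{u} C] (F : RightMod R C) :
   IsZero F ↔ ∀ x, Subsingleton (F.obj (op x)) := by
  constructor
  · intro h x
    refine ⟨fun a b => ?_⟩
    have := h.eq_of_src (𝟙 F) 0
    have h2 : ∀ v : F.obj (op x), v = 0 := fun v => congr(app $this x v)
    rw [h2 a, h2 b]
  · intro h
    rw [IsZero.iff_id_eq_zero]
    exact hom_ext fun x v => (h x).elim _ _

theorem isZero_chains (F : RightMod R (TransporterCat G P)) {n : ℕ} (hn : Nat.card P ≤ n) :
    IsZero (F.chains n) := by
  have := Chain.isEmpty hn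
  rw [isZero_iff]
  intro x
  exact inferInstanceAs (Subsingleton (∀ σ : Chain P n, F.obj (op ⟨σ.last⟩)))

theorem homologyClass_eq (F : RightMod R (TransporterCat G P)) :
    F.homologyClass =
      ∑ i ∈ Finset.range (Nat.card P), (-1 : ℤ) ^ i • G0.mk (F.chains i) :=
  G0.sum_homology F.chainComplex _ (F.isZero_chains le_rfl)

/-- Functoriality of `C_n(P; -)`. -/
def chainsMap {F F' : RightMod R (TransporterCat G P)} (η : F ⟶ F') (n : ℕ) :
    F.chains n ⟶ F'.chains n :=
  homMk (fun _ => LinearMap.pi fun σ => app η ⟨σ.last⟩ ∘ₗ LinearMap.proj σ)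
    fun {_ _} (g : G) (_ : ∀ σ : Chain P n, F.obj (op ⟨σ.last⟩)) =>
      funext fun σ => app_act η (TransporterCat.conj g σ) _

theorem chains_shortExact {S : ShortComplex (RightMod R (TransporterCat G P))}
    (hS : S.ShortExact) (n : ℕ) : (ShortComplex.mk (chainsMap S.f n) (chainsMap S.g n) (by
      refine hom_ext fun _ v => ?_
      refine funext fun σ : Chain P n => ?_
      exact congr(app $(S.zero) ⟨σ.last⟩ (v σ)))).ShortExact := by
  rw [shortExact_iff] at hS ⊢
  intro _
  refine ⟨fun v w h => ?_, fun v => ⟨fun h => ?_, ?_⟩, fun v => ?_⟩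
  · exact funext fun σ : Chain P n => (hS ⟨σ.last⟩).1 (congrFun h σ)
  · choose w hw using fun σ : Chain P n => ((hS ⟨σ.last⟩).2.1 (v σ)).1 (congrFun h σ)
    exact ⟨w, funext hw⟩
  · rintro ⟨w, rfl⟩
    exact funext fun σ : Chain P n => ((hS ⟨σ.last⟩).2.1 _).2 ⟨w σ, rfl⟩
  · choose w hw using fun σ : Chain P n => (hS ⟨σ.last⟩).2.2 (v σ)
    exact ⟨w, funext hw⟩

variable (R G P) in
/-- The homomorphism `lk_π : G₀(R P ⋊ G) → G₀(RG)`, `[F] ↦ ∑ i, (-1)^i [H_i(P; F)]`. -/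
noncomputable def lk : G0 (RightMod R (TransporterCat G P)) →+ G0 (RightMod R (SingleObj G)) :=
  G0.lift homologyClass fun S hS => by
    simp only [homologyClass_eq, ← Finset.sum_add_distrib, ← smul_add]
    exact Finset.sum_congr rfl fun i _ =>
      congrArg _ (G0.mk_shortExact (chains_shortExact hS i))

end

variable (R G P) in
/-- The restriction functor `Res_π`, `M ↦ κ_M`: precomposition with `π`. -/
def res : RightMod R (SingleObj G) ⥤ RightMod R (TransporterCat G P) :=
  (Functor.whiskeringLeft _ _ _).obj (TransporterCat.π G P).op

instance : (res R G P).PreservesZeroMorphisms := ⟨fun _ _ => rfl⟩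

theorem res_shortExact {S : ShortComplex (RightMod R (SingleObj G))}
    (hS : S.ShortExact) : (S.map (res R G P)).ShortExact := by
  rw [shortExact_iff] at hS ⊢
  exact fun x => hS _

end RightMod

namespace RightMod

variable {R : Type u} [Field R] {G P : Type u} [Group G] [PartialOrder P]
  [MulAction G P] [CovariantClass G P HSMul.hSMul LE.le]

theorem smul_le_of {n : ℕ} {x y : TransporterCat G P} (α : x ⟶ y) {σ : Chain P n}
    (h : σ.last ≤ x.pt) : (α.1 • σ).last ≤ y.pt :=
  (smul_mono_right α.1 h).trans α.2

section
variable [Finite P]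

/-- Translation of chains along a morphism of `P ⋊ G`. -/
def upShift {n : ℕ} {x y : TransporterCat G P} (α : x ⟶ y) (σ : {σ : Chain P n // σ.last ≤ x.pt}) :
    {σ : Chain P n // σ.last ≤ y.pt} := ⟨α.1 • σ.1, smul_le_of α σ.2⟩

/-- The right adjoint of `C_n(P; -)`, used to show that `C_n(P; -)` preserves projectives. -/
def cochains (n : ℕ) (M : RightMod R (SingleObj G)) : RightMod R (TransporterCat G P) :=
  mk (fun x => {σ : Chain P n // σ.last ≤ x.pt} → M.obj (op (SingleObj.star G)))
    (fun {x _} α => LinearMap.pi fun σ : {σ : Chain P n // σ.last ≤ x.pt} =>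
      M.act ((TransporterCat.π G P).map α) ∘ₗ LinearMap.proj (upShift α σ))
    (fun _ f => funext fun σ =>
      (M.act_id _ _).trans (congrArg f (Subtype.ext (one_smul G σ.1))))
    (fun {_ _ _} β α f => funext fun σ =>
      (M.act_comp ((TransporterCat.π G P).map β) ((TransporterCat.π G P).map α) _).trans
        (congrArg (fun τ => M.act _ (M.act _ (f τ))) (Subtype.ext (mul_smul α.1 β.1 σ.1))))

/-- Functoriality of `cochains n`. -/
def cochainsMap (n : ℕ) {M N : RightMod R (SingleObj G)} (e : M ⟶ N) :
    cochains (P := P) n M ⟶ cochains n N :=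
  homMk (fun _ => LinearMap.pi fun σ => app e _ ∘ₗ LinearMap.proj σ)
    fun {x y} α (v : {σ : Chain P n // σ.last ≤ y.pt} → M.obj (op (SingleObj.star G))) =>
      funext fun σ : {σ : Chain P n // σ.last ≤ x.pt} =>
        app_act e ((TransporterCat.π G P).map α) (v ⟨α.1 • σ.1, smul_le_of α σ.2⟩)

/-- The morphism of `P ⋊ G` coming from `p ≤ x` in `P`. -/
def toObj {x : TransporterCat G P} {p : P} (h : p ≤ x.pt) : (⟨p⟩ : TransporterCat G P) ⟶ x :=
  TransporterCat.incl G h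

theorem projective_chains (F : RightMod R (TransporterCat G P)) [Projective F] (n : ℕ) :
    Projective (F.chains n) := by
  refine ⟨fun {N M} f e he => ?_⟩
  have hepi : Epi (cochainsMap (P := P) n e) := by
    rw [epi_iff] at he ⊢
    intro x w
    choose v hv using fun σ : {σ : Chain P n // σ.last ≤ x.pt} => he (SingleObj.star G) (w σ)
    exact ⟨v, funext hv⟩
  let fhat : F ⟶ cochains n M := homMk
    (fun x => LinearMap.pi fun σ : {σ : Chain P n // σ.last ≤ x.pt} =>
      app f (SingleObj.star G) ∘ₗ F.single σ.1 ∘ₗ F.act (toObj σ.2))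
    fun {x y} α v => funext fun σ : {σ : Chain P n // σ.last ≤ x.pt} => by
      refine Eq.trans ?_ (app_act f ((TransporterCat.π G P).map α) _)
      refine congrArg (app f (SingleObj.star G)) (funext fun τ => ?_)
      refine Eq.trans ?_ (F.single_act α.1 σ.1 τ _).symm
      refine congrArg (fun w => F.single σ.1 w τ) ?_
      refine (F.act_comp _ _ _).symm.trans (Eq.trans ?_ (F.act_comp _ _ _))
      congr 2
      exact TransporterCat.hom_ext ((mul_one _).trans (one_mul _).symm)
  let k := Projective.factorThru fhat (cochainsMap n e)
  have hk : k ≫ cochainsMap n e = fhat := Projective.factorThru_comp _ _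
  have hk' : ∀ (x : TransporterCat G P) (v : F.obj (op x)) (σ : {σ : Chain P n // σ.last ≤ x.pt}),
      app e (SingleObj.star G)
        ((show {σ : Chain P n // σ.last ≤ x.pt} → N.obj (op (SingleObj.star G)) from app k x v) σ) =
      app f (SingleObj.star G) (F.single σ.1 (F.act (toObj σ.2) v)) := fun x v σ =>
    congr($(congr(app $hk x v)) σ)
  let kk : ∀ σ : Chain P n, F.obj (op ⟨σ.last⟩) →ₗ[R] N.obj (op (SingleObj.star G)) := fun σ =>
    (LinearMap.proj (⟨σ, le_rfl⟩ : {τ : Chain P n // τ.last ≤ σ.last}) :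
      ({τ : Chain P n // τ.last ≤ σ.last} → N.obj (op (SingleObj.star G))) →ₗ[R] _) ∘ₗ
      (show F.obj (op ⟨σ.last⟩) →ₗ[R]
        ({τ : Chain P n // τ.last ≤ σ.last} → N.obj (op (SingleObj.star G))) from app k ⟨σ.last⟩)
  have hkk : ∀ (g : G) (σ : Chain P n) (w : F.obj (op ⟨(g • σ).last⟩)),
      kk σ (F.act (TransporterCat.conj g σ) w) =
        N.act (x := SingleObj.star G) (y := SingleObj.star G) g (kk (g • σ) w) := fun g σ w =>
    congrFun (app_act k (TransporterCat.conj g σ) w) (⟨σ, le_rfl⟩ : {τ : Chain P n // τ.last ≤ σ.last})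
  have hkk2 : ∀ (σ : Chain P n) (v : F.obj (op ⟨σ.last⟩)), app e (SingleObj.star G) (kk σ v) =
      app f (SingleObj.star G) (F.single σ v) := fun σ v =>
    (hk' ⟨σ.last⟩ v ⟨σ, le_rfl⟩).trans
      (congrArg (fun w => app f (SingleObj.star G) (F.single σ w)) (F.act_id _ v))
  refine ⟨homMk (fun _ => ∑ σ : Chain P n, kk σ ∘ₗ LinearMap.proj σ) ?_, ?_⟩
  · intro _ _ (g : G) (v : ∀ σ : Chain P n, F.obj (op ⟨σ.last⟩))
    refine (LinearMap.sum_apply _ _ _).trans (Eq.trans ?_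
      (congrArg (N.act (x := SingleObj.star G) (y := SingleObj.star G) g)
        (LinearMap.sum_apply _ _ _)).symm)
    rw [map_sum]
    exact Fintype.sum_equiv (MulAction.toPerm g : Equiv.Perm (Chain P n)) _ _
      fun σ => hkk g σ (v (g • σ))
  · refine hom_ext fun _ (v : ∀ σ : Chain P n, F.obj (op ⟨σ.last⟩)) => ?_
    refine (congrArg (app e (SingleObj.star G)) (LinearMap.sum_apply _ _ _)).trans ?_
    rw [map_sum]
    refine Eq.trans ?_ (congrArg (app f (SingleObj.star G)) (F.sum_single v))
    refine (Finset.sum_congr rfl fun σ _ => hkk2 σ (v σ)).trans ?_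
    exact (map_sum (app f (SingleObj.star G)) (fun σ => F.single σ (v σ)) _).symm
end
end RightMod

namespace RightMod

variable {R : Type u} [Field R] {G P : Type u} [Group G] [PartialOrder P]
  [MulAction G P] [CovariantClass G P HSMul.hSMul LE.le]

/-- A `G`-stable relation between a `G`-set `X` and `P`, convex in the second variable. These serve to
show that `Res_π` maps projectives to classes generated by projectives. -/
structure ConvexRel (G P X : Type u) [Group G] [PartialOrder P] [MulAction G P] [MulAction G X] where
  rel : X → P → Prop
  smul_iff : ∀ (g : G) ξ p, rel (g • ξ) (g • p) ↔ rel ξ p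
  convex : ∀ {ξ p q r}, p ≤ q → q ≤ r → rel ξ p → rel ξ r → rel ξ q

section
variable {X : Type u} [MulAction G X]

/-- The component at `ξ` of a family, extended by zero. -/
noncomputable def ext0 (Q : ConvexRel G P X) (M : RightMod R (SingleObj G)) (y : P) (ξ : X) :
    ({ξ : X // Q.rel ξ y} → M.obj (op (SingleObj.star G))) →ₗ[R] M.obj (op (SingleObj.star G)) :=
  open Classical in if h : Q.rel ξ y then LinearMap.proj ⟨ξ, h⟩ else 0

theorem ext0_pos (Q : ConvexRel G P X) (M : RightMod R (SingleObj G)) {y : P} {ξ : X}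
    (h : Q.rel ξ y) (v) : ext0 Q M y ξ v = v ⟨ξ, h⟩ := by
  rw [ext0, dif_pos h]; rfl

theorem ext0_neg (Q : ConvexRel G P X) (M : RightMod R (SingleObj G)) {y : P} {ξ : X}
    (h : ¬ Q.rel ξ y) (v) : ext0 Q M y ξ v = 0 := by
  rw [ext0, dif_neg h]; rfl

variable [Finite X]

/-- The presheaf `y ↦ ⨁_{ξ, Q ξ y} M`. -/
noncomputable def spread (Q : ConvexRel G P X) (M : RightMod R (SingleObj G)) :
    RightMod R (TransporterCat G P) :=
  mk (fun y => {ξ : X // Q.rel ξ y.pt} → M.obj (op (SingleObj.star G)))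
    (fun {x y} α => LinearMap.pi fun ξ : {ξ : X // Q.rel ξ x.pt} =>
      M.act ((TransporterCat.π G P).map α) ∘ₗ ext0 Q M y.pt (α.1 • ξ.1))
    (fun x v => funext fun ξ : {ξ : X // Q.rel ξ x.pt} => by
      refine (M.act_id _ _).trans ?_
      have h : (𝟙 x : x ⟶ x).1 • ξ.1 = ξ.1 := one_smul G ξ.1
      rw [h, ext0_pos Q M ξ.2])
    (fun {x y z} β α v => funext fun ξ : {ξ : X // Q.rel ξ x.pt} => by
      refine (M.act_comp ((TransporterCat.π G P).map β) ((TransporterCat.π G P).map α) _).trans ?_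
      refine congrArg (M.act ((TransporterCat.π G P).map β)) ?_
      change M.act ((TransporterCat.π G P).map α) (ext0 Q M z.pt ((β ≫ α).1 • ξ.1) v) =
        ext0 Q M y.pt (β.1 • ξ.1) (fun ξ => M.act ((TransporterCat.π G P).map α)
          (ext0 Q M z.pt (α.1 • ξ.1) v))
      have h : (β ≫ α).1 • ξ.1 = α.1 • β.1 • ξ.1 := mul_smul _ _ _
      rw [h]
      by_cases h1 : Q.rel (β.1 • ξ.1) y.pt
      · rw [ext0_pos Q M h1]
      · rw [ext0_neg Q M h1, ext0_neg, map_zero]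
        intro h2
        apply h1
        rw [← Q.smul_iff α.1]
        refine Q.convex (smul_mono_right α.1 β.2) α.2 ?_ h2
        rw [Q.smul_iff, Q.smul_iff]
        exact ξ.2)

/-- A `G`-stable relation between `X` and `P`, downward closed in the second variable. -/
structure DownRel (G P X : Type u) [Group G] [PartialOrder P] [MulAction G P] [MulAction G X] where
  rel : X → P → Prop
  smul_iff : ∀ (g : G) ξ p, rel (g • ξ) (g • p) ↔ rel ξ p
  down : ∀ {ξ p q}, p ≤ q → rel ξ q → rel ξ p

/-- The part of `Q` inside `D`. -/
def ConvexRel.inter (Q : ConvexRel G P X) (D : DownRel G P X) : ConvexRel G P X where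
  rel ξ p := Q.rel ξ p ∧ D.rel ξ p
  smul_iff g ξ p := by rw [Q.smul_iff, D.smul_iff]
  convex h h' h1 h2 := ⟨Q.convex h h' h1.1 h2.1, D.down h' h2.2⟩

/-- The part of `Q` outside `D`. -/
def ConvexRel.diff (Q : ConvexRel G P X) (D : DownRel G P X) : ConvexRel G P X where
  rel ξ p := Q.rel ξ p ∧ ¬ D.rel ξ p
  smul_iff g ξ p := by rw [Q.smul_iff, D.smul_iff]
  convex h h' h1 h2 := ⟨Q.convex h h' h1.1 h2.1, fun h3 => h1.2 (D.down h h3)⟩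

theorem ConvexRel.inter_mk {Q : ConvexRel G P X} {D : DownRel G P X} {ξ : X} {p : P}
    (h : Q.rel ξ p) (h' : D.rel ξ p) : (Q.inter D).rel ξ p := ⟨h, h'⟩
theorem ConvexRel.inter_left {Q : ConvexRel G P X} {D : DownRel G P X} {ξ : X} {p : P}
    (h : (Q.inter D).rel ξ p) : Q.rel ξ p := h.1
theorem ConvexRel.inter_right {Q : ConvexRel G P X} {D : DownRel G P X} {ξ : X} {p : P}
    (h : (Q.inter D).rel ξ p) : D.rel ξ p := h.2
theorem ConvexRel.diff_mk {Q : ConvexRel G P X} {D : DownRel G P X} {ξ : X} {p : P}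
    (h : Q.rel ξ p) (h' : ¬ D.rel ξ p) : (Q.diff D).rel ξ p := ⟨h, h'⟩
theorem ConvexRel.diff_left {Q : ConvexRel G P X} {D : DownRel G P X} {ξ : X} {p : P}
    (h : (Q.diff D).rel ξ p) : Q.rel ξ p := h.1
theorem ConvexRel.diff_right {Q : ConvexRel G P X} {D : DownRel G P X} {ξ : X} {p : P}
    (h : (Q.diff D).rel ξ p) : ¬ D.rel ξ p := h.2

theorem spread_split (Q : ConvexRel G P X) (D : DownRel G P X) (M : RightMod R (SingleObj G)) :
    G0.mk (spread Q M) = G0.mk (spread (Q.inter D) M) + G0.mk (spread (Q.diff D) M) := by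
  let f : spread (Q.inter D) M ⟶ spread Q M := homMk
    (fun y => LinearMap.pi fun ξ : {ξ : X // Q.rel ξ y.pt} => ext0 (Q.inter D) M y.pt ξ.1)
    fun {x y} α (v : {ξ : X // (Q.inter D).rel ξ y.pt} → M.obj (op (SingleObj.star G))) => funext fun ξ : {ξ : X // Q.rel ξ x.pt} => by
      change ext0 (Q.inter D) M x.pt ξ.1 (fun ξ => M.act ((TransporterCat.π G P).map α)
          (ext0 (Q.inter D) M y.pt (α.1 • ξ.1) v)) = M.act ((TransporterCat.π G P).map α)
          (ext0 Q M y.pt (α.1 • ξ.1) (fun ξ => ext0 (Q.inter D) M y.pt ξ.1 v))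
      by_cases h2 : Q.rel (α.1 • ξ.1) y.pt
      · rw [ext0_pos Q M h2]
        by_cases h1 : D.rel ξ.1 x.pt
        · rw [ext0_pos (Q.inter D) M (ConvexRel.inter_mk ξ.2 h1)]
        · rw [ext0_neg (Q.inter D) M fun h => h1 (ConvexRel.inter_right h), ext0_neg (Q.inter D) M, map_zero]
          exact fun h => h1 ((D.smul_iff α.1 _ _).1 (D.down α.2 (ConvexRel.inter_right h)))
      · rw [ext0_neg Q M h2, map_zero]
        by_cases h1 : D.rel ξ.1 x.pt
        · rw [ext0_pos (Q.inter D) M (ConvexRel.inter_mk ξ.2 h1), ext0_neg (Q.inter D) M, map_zero]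
          exact fun h => h2 (ConvexRel.inter_left h)
        · rw [ext0_neg (Q.inter D) M fun h => h1 (ConvexRel.inter_right h)]
  let g : spread Q M ⟶ spread (Q.diff D) M := homMk
    (fun y => LinearMap.pi fun ξ : {ξ : X // (Q.diff D).rel ξ y.pt} => ext0 Q M y.pt ξ.1)
    fun {x y} α (v : {ξ : X // Q.rel ξ y.pt} → M.obj (op (SingleObj.star G))) => funext fun ξ : {ξ : X // (Q.diff D).rel ξ x.pt} => by
      change ext0 Q M x.pt ξ.1 (fun ξ => M.act ((TransporterCat.π G P).map α)
          (ext0 Q M y.pt (α.1 • ξ.1) v)) = M.act ((TransporterCat.π G P).map α)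
          (ext0 (Q.diff D) M y.pt (α.1 • ξ.1) (fun ξ => ext0 Q M y.pt ξ.1 v))
      rw [ext0_pos Q M (ConvexRel.diff_left ξ.2)]
      by_cases h2 : Q.rel (α.1 • ξ.1) y.pt
      · rw [ext0_pos (Q.diff D) M]
        exact ConvexRel.diff_mk h2 (fun h => ConvexRel.diff_right ξ.2 ((D.smul_iff α.1 _ _).1 (D.down α.2 h)))
      · rw [ext0_neg Q M h2, ext0_neg (Q.diff D) M fun h => h2 (ConvexRel.diff_left h)]
  have hfg : f ≫ g = 0 := hom_ext fun y (v : {ξ : X // (Q.inter D).rel ξ y.pt} → M.obj (op (SingleObj.star G))) => funext fun ξ : {ξ : X // (Q.diff D).rel ξ y.pt} => by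
    change ext0 Q M y.pt ξ.1 (fun ξ => ext0 (Q.inter D) M y.pt ξ.1 v) = 0
    rw [ext0_pos Q M (ConvexRel.diff_left ξ.2), ext0_neg (Q.inter D) M fun h => ConvexRel.diff_right ξ.2 (ConvexRel.inter_right h)]
  refine G0.mk_shortExact (S := ShortComplex.mk f g hfg) ?_
  rw [shortExact_iff]
  refine fun y => ⟨fun (v w : {ξ : X // (Q.inter D).rel ξ y.pt} → M.obj (op (SingleObj.star G))) h => ?_,
    fun (v : {ξ : X // Q.rel ξ y.pt} → M.obj (op (SingleObj.star G))) => ⟨fun h => ?_, ?_⟩,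
    fun (v : {ξ : X // (Q.diff D).rel ξ y.pt} → M.obj (op (SingleObj.star G))) => ?_⟩
  · refine funext fun ξ : {ξ : X // (Q.inter D).rel ξ y.pt} => ?_
    have h1 : ext0 (Q.inter D) M y.pt ξ.1 v = ext0 (Q.inter D) M y.pt ξ.1 w :=
      congrFun h (⟨ξ.1, ξ.2.1⟩ : {ξ : X // Q.rel ξ y.pt})
    rwa [ext0_pos (Q.inter D) M ξ.2, ext0_pos (Q.inter D) M ξ.2] at h1
  · refine ⟨fun ξ : {ξ : X // (Q.inter D).rel ξ y.pt} => ext0 Q M y.pt ξ.1 v,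
      funext fun ξ : {ξ : X // Q.rel ξ y.pt} => ?_⟩
    change ext0 (Q.inter D) M y.pt ξ.1 (fun ξ => ext0 Q M y.pt ξ.1 v) = v ξ
    by_cases h1 : D.rel ξ.1 y.pt
    · rw [ext0_pos (Q.inter D) M (ConvexRel.inter_mk ξ.2 h1), ext0_pos Q M ξ.2]
    · rw [ext0_neg (Q.inter D) M fun h => h1 (ConvexRel.inter_right h)]
      have h2 : ext0 Q M y.pt ξ.1 v = 0 :=
        congrFun h (⟨ξ.1, ξ.2, h1⟩ : {ξ : X // (Q.diff D).rel ξ y.pt})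
      rw [ext0_pos Q M ξ.2] at h2
      exact h2.symm
  · rintro ⟨w, rfl⟩
    exact congr(app $hfg y w)
  · refine ⟨fun ξ : {ξ : X // Q.rel ξ y.pt} => ext0 (Q.diff D) M y.pt ξ.1 v,
      funext fun ξ : {ξ : X // (Q.diff D).rel ξ y.pt} => ?_⟩
    change ext0 Q M y.pt ξ.1 (fun ξ => ext0 (Q.diff D) M y.pt ξ.1 v) = v ξ
    rw [ext0_pos Q M (ConvexRel.diff_left ξ.2), ext0_pos (Q.diff D) M ξ.2]

theorem spread_iso {X' : Type u} [MulAction G X'] [Finite X'] (Q : ConvexRel G P X)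
    (Q' : ConvexRel G P X') (M : RightMod R (SingleObj G))
    (e : ∀ y : P, {ξ : X' // Q'.rel ξ y} ≃ {ξ : X // Q.rel ξ y})
    (he : ∀ {x y : P} (g : G) (_ : g • x ≤ y) (ξ : {ξ : X' // Q'.rel ξ x}),
      (Q'.rel (g • ξ.1) y ↔ Q.rel (g • (e x ξ).1) y) ∧
      ∀ h' : Q'.rel (g • ξ.1) y, (e y ⟨g • ξ.1, h'⟩).1 = g • (e x ξ).1) :
    G0.mk (spread Q M) = G0.mk (spread Q' M) := by
  let f : spread Q M ⟶ spread Q' M := homMk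
    (fun y => LinearMap.pi fun ξ : {ξ : X' // Q'.rel ξ y.pt} => LinearMap.proj (e y.pt ξ))
    fun {x y} α (v : {ξ : X // Q.rel ξ y.pt} → M.obj (op (SingleObj.star G))) => funext fun ξ : {ξ : X' // Q'.rel ξ x.pt} => by
      change M.act ((TransporterCat.π G P).map α) (ext0 Q M y.pt (α.1 • (e x.pt ξ).1) v) =
        M.act ((TransporterCat.π G P).map α) (ext0 Q' M y.pt (α.1 • ξ.1) (fun ξ => v (e y.pt ξ)))
      obtain ⟨h1, h2⟩ := he α.1 α.2 ξ
      congr 1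
      by_cases h : Q'.rel (α.1 • ξ.1) y.pt
      · rw [ext0_pos Q' M h, ext0_pos Q M (h1.1 h)]
        exact congrArg v (Subtype.ext (h2 h).symm)
      · rw [ext0_neg Q' M h, ext0_neg Q M fun h' => h (h1.2 h')]
  have : Mono f := (mono_iff f).2 fun y (v w : {ξ : X // Q.rel ξ y.pt} → M.obj (op (SingleObj.star G))) h => by
    refine funext fun ξ : {ξ : X // Q.rel ξ y.pt} => ?_
    have h1 := congrFun h ((e y.pt).symm ξ)
    change v (e y.pt ((e y.pt).symm ξ)) = w (e y.pt ((e y.pt).symm ξ)) at h1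
    rwa [Equiv.apply_symm_apply] at h1
  have : Epi f := (epi_iff f).2 fun y (v : {ξ : X' // Q'.rel ξ y.pt} → M.obj (op (SingleObj.star G))) => by
    refine ⟨fun ξ : {ξ : X // Q.rel ξ y.pt} => v ((e y.pt).symm ξ),
      funext fun ξ : {ξ : X' // Q'.rel ξ y.pt} => ?_⟩
    exact congrArg v (Equiv.symm_apply_apply (e y.pt) ξ)
  have := isIso_of_mono_of_epi f
  exact G0.mk_iso (asIso f)

end
end RightMod

namespace RightMod

variable {R : Type u} [Field R] {G P : Type u} [Group G] [PartialOrder P]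
  [MulAction G P] [CovariantClass G P HSMul.hSMul LE.le]

theorem smul_le_smul_iff_act (g : G) (p q : P) : g • p ≤ g • q ↔ p ≤ q := by
  refine ⟨fun h => ?_, fun h => smul_mono_right g h⟩
  simpa using smul_mono_right g⁻¹ h

section
variable {X : Type u} [MulAction G X] [Finite X]

/-- The relation `S ξ ∧ p ≤ a ξ`. -/
def ConvexRel.below (S : X → Prop) (hS : ∀ (g : G) ξ, S (g • ξ) ↔ S ξ) (a : X → P)
    (ha : ∀ (g : G) ξ, a (g • ξ) = g • a ξ) : ConvexRel G P X where
  rel ξ p := S ξ ∧ p ≤ a ξ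
  smul_iff g ξ p := by rw [hS, ha, smul_le_smul_iff_act]
  convex _ h' h1 h2 := ⟨h1.1, h'.trans h2.2⟩

variable (S : X → Prop) (hS : ∀ (g : G) ξ, S (g • ξ) ↔ S ξ) (a : X → P)
    (ha : ∀ (g : G) ξ, a (g • ξ) = g • a ξ)

/-- The action of `G` on a stable subset. -/
def smulSub (g : G) (ξ : {ξ : X // S ξ}) : {ξ : X // S ξ} := ⟨g • ξ.1, (hS g ξ.1).2 ξ.2⟩

/-- The morphism `1 g : a ξ ⟶ a (g • ξ)`. -/
def arrow (g : G) (ξ : {ξ : X // S ξ}) :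
    (⟨a ξ.1⟩ : TransporterCat G P) ⟶ ⟨a (smulSub S hS g ξ).1⟩ :=
  ⟨g, (ha g ξ.1).ge⟩

theorem act_sub (F : RightMod R (TransporterCat G P))
    (f : ∀ ξ : {ξ : X // S ξ}, F.obj (op ⟨a ξ.1⟩)) {p : P} {σ τ : {ξ : X // S ξ}} (h : σ = τ)
    (α : (⟨p⟩ : TransporterCat G P) ⟶ ⟨a σ.1⟩) (β : (⟨p⟩ : TransporterCat G P) ⟶ ⟨a τ.1⟩)
    (hαβ : α.1 = β.1) : F.act α (f σ) = F.act β (f τ) := by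
  subst h
  rw [TransporterCat.hom_ext hαβ]

/-- The right `RG`-module `⨁_{ξ, S ξ} F(a ξ)`. -/
def gather (F : RightMod R (TransporterCat G P)) : RightMod R (SingleObj G) :=
  mk (fun _ => ∀ ξ : {ξ : X // S ξ}, F.obj (op ⟨a ξ.1⟩))
    (fun {_ _} (g : G) => LinearMap.pi fun ξ : {ξ : X // S ξ} =>
      F.act (arrow S hS a ha g ξ) ∘ₗ LinearMap.proj (smulSub S hS g ξ))
    (fun _ f => funext fun ξ : {ξ : X // S ξ} =>
      (act_sub S a F f (σ := smulSub S hS 1 ξ) (τ := ξ) (Subtype.ext (one_smul G ξ.1)) _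
        (𝟙 _) rfl).trans (F.act_id _ _))
    (fun {_ _ _} (h g : G) f => funext fun ξ : {ξ : X // S ξ} => by
      refine (act_sub S a F f (σ := smulSub S hS (g * h) ξ)
        (τ := smulSub S hS g (smulSub S hS h ξ)) (Subtype.ext (mul_smul g h ξ.1)) _
        (arrow S hS a ha h ξ ≫ arrow S hS a ha g (smulSub S hS h ξ)) rfl).trans ?_
      exact F.act_comp _ _ _)

/-- Functoriality of `gather`. -/
def gatherMap {F F' : RightMod R (TransporterCat G P)} (η : F ⟶ F') :
    gather S hS a ha F ⟶ gather S hS a ha F' :=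
  homMk (fun _ => LinearMap.pi fun ξ : {ξ : X // S ξ} => app η ⟨a ξ.1⟩ ∘ₗ LinearMap.proj ξ)
    fun {_ _} (g : G) (_ : ∀ ξ : {ξ : X // S ξ}, F.obj (op ⟨a ξ.1⟩)) =>
      funext fun ξ => app_act η (arrow S hS a ha g ξ) _

/-- The inclusion of the summand of `ξ`. -/
noncomputable def singtoObj (Q : ConvexRel G P X) (M : RightMod R (SingleObj G)) (y : P)
    (ξ : {ξ : X // Q.rel ξ y}) : M.obj (op (SingleObj.star G)) →ₗ[R]
      ({ξ : X // Q.rel ξ y} → M.obj (op (SingleObj.star G))) :=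
  open Classical in LinearMap.pi fun τ => if τ.1 = ξ.1 then LinearMap.id else 0

theorem singtoObj_self (Q : ConvexRel G P X) (M : RightMod R (SingleObj G)) {y : P}
    {ξ τ : {ξ : X // Q.rel ξ y}} (h : τ.1 = ξ.1) (m) : singtoObj Q M y ξ m τ = m := by
  rw [singtoObj, LinearMap.pi_apply, if_pos h, LinearMap.id_apply]

theorem singtoObj_ne (Q : ConvexRel G P X) (M : RightMod R (SingleObj G)) {y : P}
    {ξ τ : {ξ : X // Q.rel ξ y}} (h : τ.1 ≠ ξ.1) (m) : singtoObj Q M y ξ m τ = 0 := by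
  rw [singtoObj, LinearMap.pi_apply, if_neg h, LinearMap.zero_apply]

theorem spread_act_single (Q : ConvexRel G P X) (M : RightMod R (SingleObj G))
    {x y : TransporterCat G P} (α : x ⟶ y) (ξ : {ξ : X // Q.rel ξ x.pt})
    (τ : {ξ : X // Q.rel ξ y.pt}) (h : τ.1 = α.1 • ξ.1) (m : M.obj (op (SingleObj.star G))) :
    (spread Q M).act α (singtoObj Q M y.pt τ m) =
      singtoObj Q M x.pt ξ (M.act ((TransporterCat.π G P).map α) m) := by
  refine funext fun ζ : {ξ : X // Q.rel ξ x.pt} => ?_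
  change M.act ((TransporterCat.π G P).map α)
    (ext0 Q M y.pt (α.1 • ζ.1) (singtoObj Q M y.pt τ m)) = _
  by_cases h3 : ζ.1 = ξ.1
  · have h4 : α.1 • ζ.1 = τ.1 := by rw [h, h3]
    have h2 : Q.rel (α.1 • ζ.1) y.pt := by rw [h4]; exact τ.2
    rw [ext0_pos Q M h2, singtoObj_self Q M h4, singtoObj_self Q M h3]
  · rw [singtoObj_ne Q M h3]
    by_cases h2 : Q.rel (α.1 • ζ.1) y.pt
    · rw [ext0_pos Q M h2, singtoObj_ne Q M, map_zero]
      rw [h]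
      exact fun h5 => h3 (MulAction.injective α.1 h5)
    · rw [ext0_neg Q M h2, map_zero]

theorem spread_ext (Q : ConvexRel G P X) (M : RightMod R (SingleObj G)) {y : P}
    {V : Type u} [AddCommGroup V] [Module R V]
    {f g : ({ξ : X // Q.rel ξ y} → M.obj (op (SingleObj.star G))) →ₗ[R] V}
    (h : ∀ ξ m, f (singtoObj Q M y ξ m) = g (singtoObj Q M y ξ m)) : f = g := by
  classical
  have := Fintype.ofFinite {ξ : X // Q.rel ξ y}
  refine LinearMap.ext fun v => ?_
  have hv : v = ∑ ξ, singtoObj Q M y ξ (v ξ) := by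
    funext τ
    rw [Finset.sum_apply, Finset.sum_eq_single τ, singtoObj_self Q M rfl]
    · exact fun ξ _ hξ => singtoObj_ne Q M (fun h' => hξ (Subtype.ext h'.symm)) _
    · simp
  rw [hv, map_sum, map_sum]
  exact Finset.sum_congr rfl fun ξ _ => h ξ _

theorem projective_below (M : RightMod R (SingleObj G)) [Projective M] :
    Projective (spread (ConvexRel.below S hS a ha) M) := by
  classical
  set Q := ConvexRel.below S hS a ha with hQ
  have hmem : ∀ ξ : {ξ : X // S ξ}, Q.rel ξ.1 (a ξ.1) := fun ξ => ⟨ξ.2, le_rfl⟩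
  have hle : ∀ {y : P} (ξ : {ξ : X // Q.rel ξ y}), y ≤ a ξ.1 := fun ξ => ξ.2.2
  have hSS : ∀ {y : P} (ξ : {ξ : X // Q.rel ξ y}), S ξ.1 := fun ξ => ξ.2.1
  refine ⟨fun {E F} f e he => ?_⟩
  have hepi : Epi (gatherMap S hS a ha e) := by
    rw [epi_iff] at he ⊢
    intro _ w
    choose v hv using fun ξ : {ξ : X // S ξ} => he ⟨a ξ.1⟩ (w ξ)
    exact ⟨v, funext hv⟩
  let fhat : M ⟶ gather S hS a ha F := homMk
    (fun _ => LinearMap.pi fun ξ : {ξ : X // S ξ} =>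
      app f ⟨a ξ.1⟩ ∘ₗ singtoObj Q M (a ξ.1) ⟨ξ.1, hmem ξ⟩)
    fun {_ _} (g : G) m => funext fun ξ : {ξ : X // S ξ} => by
      refine Eq.trans ?_ (app_act f (arrow S hS a ha g ξ) _)
      refine congrArg (app f ⟨a ξ.1⟩) ?_
      exact (spread_act_single Q M (arrow S hS a ha g ξ) ⟨ξ.1, hmem ξ⟩
        ⟨(smulSub S hS g ξ).1, hmem (smulSub S hS g ξ)⟩ rfl m).symm
  let k := Projective.factorThru fhat (gatherMap S hS a ha e)
  have hk : k ≫ gatherMap S hS a ha e = fhat := Projective.factorThru_comp _ _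
  let kk : ∀ ξ : {ξ : X // S ξ}, M.obj (op (SingleObj.star G)) →ₗ[R] E.obj (op ⟨a ξ.1⟩) := fun ξ =>
    LinearMap.proj (φ := fun ξ : {ξ : X // S ξ} => E.obj (op ⟨a ξ.1⟩)) ξ ∘ₗ
      (show M.obj (op (SingleObj.star G)) →ₗ[R]
        (∀ ξ : {ξ : X // S ξ}, E.obj (op ⟨a ξ.1⟩)) from app k (SingleObj.star G))
  have hkk2 : ∀ ξ m, app e ⟨a ξ.1⟩ (kk ξ m) =
      app f ⟨a ξ.1⟩ (singtoObj Q M (a ξ.1) ⟨ξ.1, hmem ξ⟩ m) := fun ξ m =>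
    congrFun congr(app $hk (SingleObj.star G) m) ξ
  have hkk : ∀ (g : G) ξ m, kk ξ (M.act (x := SingleObj.star G) (y := SingleObj.star G) g m) =
      E.act (arrow S hS a ha g ξ) (kk (smulSub S hS g ξ) m) := fun g ξ m =>
    congrFun (app_act k (x := SingleObj.star G) (y := SingleObj.star G) g m) ξ
  have hfin : ∀ y : P, Finite {ξ : X // Q.rel ξ y} := fun y => inferInstance
  let ft : ∀ y : P, Fintype {ξ : X // Q.rel ξ y} := fun y => Fintype.ofFinite _
  let t : ∀ y : TransporterCat G P, ({ξ : X // Q.rel ξ y.pt} → M.obj (op (SingleObj.star G))) →ₗ[R]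
      E.obj (op y) := fun y => ∑ ξ : {ξ : X // Q.rel ξ y.pt},
    E.act (toObj (hle ξ)) ∘ₗ kk ⟨ξ.1, hSS ξ⟩ ∘ₗ LinearMap.proj ξ
  have ht : ∀ (y : TransporterCat G P) (ξ : {ξ : X // Q.rel ξ y.pt}) m,
      t y (singtoObj Q M y.pt ξ m) = E.act (toObj (hle ξ)) (kk ⟨ξ.1, hSS ξ⟩ m) := fun y ξ m => by
    simp only [t, LinearMap.sum_apply]
    rw [Finset.sum_eq_single ξ]
    · rw [LinearMap.comp_apply, LinearMap.comp_apply, LinearMap.proj_apply, singtoObj_self Q M rfl]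
    · intro τ _ hτ
      rw [LinearMap.comp_apply, LinearMap.comp_apply, LinearMap.proj_apply,
        singtoObj_ne Q M fun h => hτ (Subtype.ext h), map_zero, map_zero]
    · simp
  refine ⟨homMk t fun {x y} α v => ?_, ?_⟩
  · refine LinearMap.congr_fun (spread_ext Q M (f := t x ∘ₗ (show _ →ₗ[R] ({ξ : X // Q.rel ξ x.pt} →
      M.obj (op (SingleObj.star G))) from (spread Q M).act α)) (g := E.act α ∘ₗ t y)
      fun ξ m => ?_) v
    have hξ : Q.rel (α.1⁻¹ • ξ.1) x.pt := by
      refine ⟨(hS _ _).2 (hSS ξ), ?_⟩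
      rw [ha, ← smul_le_smul_iff_act α.1, smul_inv_smul]
      exact α.2.trans (hle ξ)
    refine (congrArg (t x) (spread_act_single Q M α ⟨_, hξ⟩ ξ (smul_inv_smul _ _).symm m)).trans ?_
    refine Eq.trans ?_ (congrArg (E.act α) (ht y ξ m)).symm
    rw [ht]
    let ζ : {ξ : X // S ξ} := ⟨α.1⁻¹ • ξ.1, hSS ⟨_, hξ⟩⟩
    refine (congrArg (E.act (toObj (hle ⟨α.1⁻¹ • ξ.1, hξ⟩))) (hkk α.1 ζ m)).trans ?_
    refine (E.act_comp (toObj (hle ⟨α.1⁻¹ • ξ.1, hξ⟩)) (arrow S hS a ha α.1 ζ) _).symm.trans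
      (Eq.trans ?_ (E.act_comp α (toObj (hle ξ)) _))
    exact act_sub S a E (fun ζ => kk ζ m) (p := x.pt) (σ := smulSub S hS α.1 ζ)
      (τ := ⟨ξ.1, hSS ξ⟩) (Subtype.ext (smul_inv_smul α.1 ξ.1)) _ _
      ((mul_one α.1).trans (one_mul α.1).symm)
  · refine hom_ext fun y v => ?_
    refine LinearMap.congr_fun (spread_ext Q M (f := app e y ∘ₗ t y) (g := app f y)
      fun ξ m => ?_) v
    refine (congrArg (app e y) (ht y ξ m)).trans ?_
    refine (app_act e (toObj (hle ξ)) _).trans ?_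
    refine (congrArg (F.act (toObj (hle ξ))) (hkk2 ⟨ξ.1, hSS ξ⟩ m)).trans ?_
    refine (app_act f (toObj (hle ξ)) _).symm.trans (congrArg (app f y) ?_)
    refine (spread_act_single Q M (toObj (hle ξ)) ξ _ (one_smul G ξ.1).symm m).trans ?_
    exact congrArg _ (M.act_id _ m)

end
end RightMod

namespace RightMod

variable {R : Type u} [Field R] {G P : Type u} [Group G] [PartialOrder P]
  [MulAction G P] [CovariantClass G P HSMul.hSMul LE.le] [Finite P]

/-- A strictly monotone `G`-invariant rank function on `P`. -/
noncomputable def rk (p : P) : ℕ := (Set.Iic p).ncard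

theorem rk_lt {p q : P} (h : p < q) : rk p < rk q :=
  Set.ncard_lt_ncard (Set.Iic_ssubset_Iic.2 h) (Set.toFinite _)

theorem rk_smul (g : G) (p : P) : rk (g • p) = rk p := by
  have h : Set.Iic (g • p) = (g • ·) '' Set.Iic p := by
    ext q
    constructor
    · intro hq
      refine ⟨g⁻¹ • q, ?_, smul_inv_smul g q⟩
      rw [Set.mem_Iic, ← smul_le_smul_iff_act g, smul_inv_smul]
      exact hq
    · rintro ⟨r, hr, rfl⟩
      exact smul_mono_right g hr
  rw [rk, rk, h, Set.ncard_image_of_injective _ (MulAction.injective g)]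

variable (G) in
/-- The elements of rank less than `n`. -/
def rkDown (X : Type u) [MulAction G X] (n : ℕ) : DownRel G P X where
  rel _ p := rk p < n
  smul_iff g _ p := by rw [rk_smul]
  down h h' := by
    rcases h.eq_or_lt with rfl | h
    · exact h'
    · exact (rk_lt h).trans h'

variable (G P) in
/-- The relation `p < q` between `X × P` and `P`. -/
def ltDown (X : Type u) [MulAction G X] : DownRel G P (X × P) where
  rel ξ p := p < ξ.2
  smul_iff g ξ p := by
    rw [lt_iff_le_not_ge, lt_iff_le_not_ge, Prod.smul_snd, smul_le_smul_iff_act, smul_le_smul_iff_act]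
  down h h' := h.trans_lt h'

theorem spread_mem (M : RightMod R (SingleObj G)) [Projective M] (n : ℕ) :
    ∀ (X : Type u) [MulAction G X] [Finite X] (Q : ConvexRel G P X),
      (∀ ξ p, Q.rel ξ p → rk p < n) →
      G0.mk (spread Q M) ∈ G0.projClasses (RightMod R (TransporterCat G P)) := by
  induction n with
  | zero =>
    intro X _ _ Q h
    rw [G0.mk_isZero]
    · exact zero_mem _
    · rw [isZero_iff]
      intro y
      have : IsEmpty {ξ : X // Q.rel ξ y.pt} := ⟨fun ξ => absurd (h _ _ ξ.2) (by simp)⟩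
      exact inferInstanceAs
        (Subsingleton ({ξ : X // Q.rel ξ y.pt} → M.obj (op (SingleObj.star G))))
  | succ n ih =>
    intro X _ _ Q h
    rw [spread_split Q (rkDown G X n) M]
    refine add_mem (ih X _ fun ξ p hp => hp.2) ?_
    have hn : ∀ {ξ p}, (Q.diff (rkDown G X n)).rel ξ p → rk p = n := fun {ξ p} hp =>
      le_antisymm (Nat.lt_succ_iff.1 (h _ _ hp.1)) (not_lt.1 hp.2)
    set T := Q.diff (rkDown G X n) with hT
    let B : ConvexRel G P (X × P) := ConvexRel.below (fun ξ => T.rel ξ.1 ξ.2)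
      (fun g ξ => T.smul_iff g ξ.1 ξ.2) Prod.snd (fun _ _ => rfl)
    have hB : Projective (spread B M) := projective_below _ _ _ _ M
    have h1 : G0.mk (spread B M) ∈ G0.projClasses (RightMod R (TransporterCat G P)) :=
      AddSubgroup.subset_closure ⟨_, hB, rfl⟩
    have h2 := spread_split B (ltDown G P X) M
    have h3 : G0.mk (spread (B.inter (ltDown G P X)) M) ∈
        G0.projClasses (RightMod R (TransporterCat G P)) :=
      ih _ _ fun ξ p hp => (rk_lt hp.2).trans_eq (hn hp.1.1)
    have hsnd : ∀ {ξ : X × P} {p : P}, (B.diff (ltDown G P X)).rel ξ p → ξ.2 = p :=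
      fun {ξ p} hp => (hp.1.2.eq_or_lt.resolve_right hp.2).symm
    have h4 : G0.mk (spread T M) = G0.mk (spread (B.diff (ltDown G P X)) M) := by
      have hmk : ∀ {ξ p}, T.rel ξ p → (B.diff (ltDown G P X)).rel (ξ, p) p := fun {ξ p} hp =>
        ⟨⟨hp, le_rfl⟩, lt_irrefl _⟩
      have hof : ∀ {ξ : X × P} {p : P}, (B.diff (ltDown G P X)).rel ξ p → T.rel ξ.1 p :=
        fun {ξ p} hp => by
          have h5 : T.rel ξ.1 ξ.2 := hp.1.1
          rwa [hsnd hp] at h5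
      refine spread_iso T _ M (fun y =>
        { toFun := fun ξ => ⟨ξ.1.1, hof ξ.2⟩
          invFun := fun ξ => ⟨(ξ.1, y), hmk ξ.2⟩
          left_inv := fun ξ => Subtype.ext (Prod.ext rfl (hsnd ξ.2).symm)
          right_inv := fun ξ => rfl }) ?_
      intro x y g hxy ξ
      refine ⟨⟨fun h' => hof h', fun h' => ?_⟩, fun _ => rfl⟩
      have e1 : rk (g • x) = n := by rw [rk_smul]; exact hn (hof ξ.2)
      have e2 : g • x = y := by
        by_contra hne
        have := rk_lt (lt_of_le_of_ne hxy hne)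
        rw [e1, hn h'] at this
        exact lt_irrefl _ this
      have e3 : g • ξ.1 = (g • ξ.1.1, y) := Prod.ext rfl ((congrArg (g • ·) (hsnd ξ.2)).trans e2)
      rw [e3]
      exact hmk h'
    rw [h4]
    rw [h2] at h1
    simpa using sub_mem h1 h3

theorem mk_res_mem (M : RightMod R (SingleObj G)) [Projective M] :
    G0.mk ((res R G P).obj M) ∈ G0.projClasses (RightMod R (TransporterCat G P)) := by
  let _ : MulAction G PUnit.{u + 1} := { smul := fun _ x => x, one_smul := fun _ => rfl, mul_smul := fun _ _ _ => rfl }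
  let Q : ConvexRel G P PUnit.{u + 1} := ⟨fun _ _ => True, fun _ _ _ => Iff.rfl, fun _ _ _ _ => trivial⟩
  have h : G0.mk (spread Q M) ∈ G0.projClasses (RightMod R (TransporterCat G P)) := by
    refine spread_mem M (Nat.card P + 1) _ Q fun _ p _ => Nat.lt_succ_of_le ?_
    exact Set.ncard_le_card _
  let f : (res R G P).obj M ⟶ spread Q M := homMk
    (fun y => LinearMap.pi fun _ => LinearMap.id) fun {x y} α v => by
      refine funext fun ξ : {ξ : PUnit.{u + 1} // Q.rel ξ x.pt} => ?_
      change M.act ((TransporterCat.π G P).map α) v = M.act ((TransporterCat.π G P).map α) (ext0 Q M y.pt _ _)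
      exact (congrArg (M.act ((TransporterCat.π G P).map α))
        (ext0_pos Q M (y := y.pt) (ξ := α.1 • ξ.1) trivial (fun _ => v))).symm
  have : Mono f := (mono_iff f).2 fun y v w h =>
    congrFun h (⟨PUnit.unit, trivial⟩ : {ξ : PUnit.{u + 1} // Q.rel ξ y.pt})
  have : Epi f := (epi_iff f).2 fun y v => ⟨v (⟨PUnit.unit, trivial⟩ : {ξ : PUnit.{u + 1} // Q.rel ξ y.pt}), rfl⟩
  have := isIso_of_mono_of_epi f
  rwa [G0.mk_iso (asIso f)]

end RightMod

namespace RightMod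

section
variable (R : Type u) [Field R] (G P : Type u) [Group G] [PartialOrder P]
  [MulAction G P] [CovariantClass G P HSMul.hSMul LE.le]

/-- The homomorphism `r_π : G₀(RG) → G₀(R P ⋊ G)` of Grothendieck groups, `[M] ↦ [κ_M]`, induced by
the exact functor `Res_π`. -/
noncomputable def r :
    G0 (RightMod R (SingleObj G)) →+ G0 (RightMod R (TransporterCat G P)) :=
  G0.lift (fun M => G0.mk ((res R G P).obj M)) fun _ hS => G0.mk_shortExact (res_shortExact hS)

theorem r_mk (M : RightMod R (SingleObj G)) :
    r R G P (G0.mk M) = G0.mk ((res R G P).obj M) :=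
  G0.lift_mk _ _ M

/-- The trivial presheaf (module) on a category `C`: every object goes to `R`, every morphism to the
identity. -/
def trivial (C : Type*) [Category.{u} C] : RightMod R C :=
  (Functor.const _).obj (FGModuleCat.of R R)

variable [Finite P]

theorem lk_mk (F : RightMod R (TransporterCat G P)) :
    lk R G P (G0.mk F) = F.homologyClass :=
  G0.lift_mk _ _ F

theorem r_projClasses : G0.projClasses (RightMod R (SingleObj G)) ≤
    (G0.projClasses (RightMod R (TransporterCat G P))).comap (r R G P) := by
  rw [G0.projClasses, AddSubgroup.closure_le]
  rintro _ ⟨M, hM, rfl⟩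
  change r R G P (G0.mk M) ∈ G0.projClasses (RightMod R (TransporterCat G P))
  rw [r_mk]
  exact mk_res_mem M

theorem lk_projClasses : G0.projClasses (RightMod R (TransporterCat G P)) ≤
    (G0.projClasses (RightMod R (SingleObj G))).comap (lk R G P) := by
  rw [G0.projClasses, AddSubgroup.closure_le]
  rintro _ ⟨F, hF, rfl⟩
  change lk R G P (G0.mk F) ∈ G0.projClasses (RightMod R (SingleObj G))
  rw [lk_mk, homologyClass_eq]
  have h : ∀ i, G0.mk (F.chains i) ∈ G0.projClasses (RightMod R (SingleObj G)) := fun i =>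
    AddSubgroup.subset_closure ⟨_, projective_chains F i, rfl⟩
  exact sum_mem fun i _ => zsmul_mem (h i) _

/-- The homomorphism `r'_π` of stable Grothendieck groups induced by `r_π`. -/
noncomputable def rSt :
    StG0 (RightMod R (SingleObj G)) →+ StG0 (RightMod R (TransporterCat G P)) :=
  QuotientAddGroup.map _ _ (r R G P) (r_projClasses R G P)

/-- The homomorphism `lk'_π` of stable Grothendieck groups induced by `lk_π`. -/
noncomputable def lkSt :
    StG0 (RightMod R (TransporterCat G P)) →+ StG0 (RightMod R (SingleObj G)) :=
  QuotientAddGroup.map _ _ (lk R G P) (lk_projClasses R G P)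

/-- `P` has vanishing homology (over `R`): the homology of `P` with coefficients in the trivial
presheaf `R` is zero in all positive degrees. -/
def VanishingHomology : Prop :=
  ∀ i : ℕ, 0 < i → IsZero ((trivial R (TransporterCat G P)).homology i)

/-- The generalized Steinberg representation
`St_P(G) = ∑ i, (-1)^i [H_i(P; R)] - [R]` in `G₀(RG)`. -/
noncomputable def steinberg : G0 (RightMod R (SingleObj G)) :=
  (trivial R (TransporterCat G P)).homologyClass - G0.mk (trivial R (SingleObj G))

end

end RightMod

end GPoset

/-!
The composite `lk_π ∘ r_π` is multiplication by the class `∑ i, (-1)^i [H_i(P; R)]`.  Indeed the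
homology representation of `F` equals `∑ i, (-1)^i [C_i(P; F)]`, and for the constant presheaf `κ_M`
the module `C_i(P; κ_M)`, the families of elements of `M` indexed by the `i`-chains, is the tensor
product over `R`, with diagonal action, of `M` and the permutation module `C_i(P; R)`
(`tensorChainsIso`).  As `M ⊗ -` is exact it acts on `G₀(RG)` (`tensorG0`), whence
`lk_π (r_π [M]) = M ⊗ ∑ i, (-1)^i [H_i(P; R)]` (`lk_r_mk`).

If `P` is connected with vanishing homology, the class is that of `H_0(P; R) ≅ R`
(`homologyZeroIso`), and `lk_π ∘ r_π` is the identity.  If the class is `[R] + [Q] - [Q']` with `Q` and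
`Q'` projective, then `lk_π ∘ r_π` is the identity modulo the classes of `M ⊗ Q` and `M ⊗ Q'`, which
are projective (`projective_tensor`) because `M ⊗ -` is left adjoint to the exact functor
`Hom_R(M, -)`; so `lk'_π ∘ r'_π` is the identity.  Either way the left inverse gives injectivity
of `r` and surjectivity of `lk`.
-/

namespace GPoset

/-- A homomorphism out of `G₀` is determined by its values on classes of objects. -/
theorem G0.hom_ext {A B : Type*} [Category* A] [Abelian A] [AddCommGroup B] {f g : G0 A →+ B}
    (h : ∀ X, f (G0.mk X) = g (G0.mk X)) : f = g := by
  refine QuotientAddGroup.addMonoidHom_ext _ ?_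
  ext X
  exact h X

namespace RightMod

open scoped TensorProduct

/-! ### Tensor products of modules with the diagonal action -/

section Tensor

variable {R : Type u} [Field R] {G : Type u} [Group G]

/-- The vector space underlying a right `RG`-module. -/
abbrev carrier (M : RightMod R (SingleObj G)) : Type u := M.obj (op (SingleObj.star G))

/-- The action `m ↦ m · g` on a right `RG`-module. -/
abbrev rho (M : RightMod R (SingleObj G)) (g : G) : carrier M →ₗ[R] carrier M :=
  M.act (x := SingleObj.star G) (y := SingleObj.star G) g

theorem rho_one (M : RightMod R (SingleObj G)) (m : carrier M) : rho M 1 m = m :=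
  M.act_id _ m

/-- In `SingleObj G` the product `g * h` is `h` followed by `g`, so this is `m · (g h) = (m · g) · h`. -/
theorem rho_mul (M : RightMod R (SingleObj G)) (g h : G) (m : carrier M) :
    rho M (g * h) m = rho M h (rho M g m) :=
  M.act_comp (x := SingleObj.star G) (y := SingleObj.star G) (z := SingleObj.star G) h g m

theorem rho_rho_inv (M : RightMod R (SingleObj G)) (g : G) (m : carrier M) :
    rho M g (rho M g⁻¹ m) = m := by
  rw [← rho_mul, inv_mul_cancel, rho_one]

theorem rho_inv_rho (M : RightMod R (SingleObj G)) (g : G) (m : carrier M) :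
    rho M g⁻¹ (rho M g m) = m := by
  rw [← rho_mul, mul_inv_cancel, rho_one]

/-- The tensor product `M ⊗ N` over `R` of two right `RG`-modules, with the diagonal action
`(m ⊗ n) · g = (m · g) ⊗ (n · g)`. -/
noncomputable def tensor (M N : RightMod R (SingleObj G)) : RightMod R (SingleObj G) :=
  mk (fun _ => carrier M ⊗[R] carrier N)
    (fun {_ _} (g : G) => TensorProduct.map (rho M g) (rho N g))
    (fun _ v => by
      refine LinearMap.congr_fun (g := LinearMap.id) (TensorProduct.ext' fun m n => ?_) v
      exact congrArg₂ (· ⊗ₜ[R] ·) (rho_one M m) (rho_one N n))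
    (fun {_ _ _} (h g : G) v => by
      refine LinearMap.congr_fun (g := TensorProduct.map (rho M h) (rho N h) ∘ₗ
        TensorProduct.map (rho M g) (rho N g)) (TensorProduct.ext' fun m n => ?_) v
      exact congrArg₂ (· ⊗ₜ[R] ·) (rho_mul M g h m) (rho_mul N g h n))

/-- Functoriality of `M ⊗ -`. -/
noncomputable def tensorMap (M : RightMod R (SingleObj G)) {N N' : RightMod R (SingleObj G)}
    (e : N ⟶ N') : tensor M N ⟶ tensor M N' :=
  homMk (fun _ => (app e (SingleObj.star G)).lTensor (carrier M)) fun {_ _} (g : G) v => by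
    refine LinearMap.congr_fun
      (f := (app e (SingleObj.star G)).lTensor (carrier M) ∘ₗ TensorProduct.map (rho M g) (rho N g))
      (g := TensorProduct.map (rho M g) (rho N' g) ∘ₗ
        (app e (SingleObj.star G)).lTensor (carrier M)) (TensorProduct.ext' fun m n => ?_) v
    exact congrArg (rho M g m ⊗ₜ[R] ·)
      (app_act (x := SingleObj.star G) (y := SingleObj.star G) e g n)

theorem tensorMap_comp (M : RightMod R (SingleObj G)) {N N' N'' : RightMod R (SingleObj G)}
    {f : N ⟶ N'} {g : N' ⟶ N''} (h : f ≫ g = 0) : tensorMap M f ≫ tensorMap M g = 0 := by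
  refine hom_ext fun _ v => ?_
  refine LinearMap.congr_fun (f := (app g (SingleObj.star G)).lTensor (carrier M) ∘ₗ
    (app f (SingleObj.star G)).lTensor (carrier M)) (g := 0) (TensorProduct.ext' fun m n => ?_) v
  exact (congrArg (m ⊗ₜ[R] ·) congr(app $h (SingleObj.star G) n)).trans
    (TensorProduct.tmul_zero (carrier N'') m)

theorem tensor_shortExact (M : RightMod R (SingleObj G))
    {S : ShortComplex (RightMod R (SingleObj G))} (hS : S.ShortExact) :
    (ShortComplex.mk (tensorMap M S.f) (tensorMap M S.g) (tensorMap_comp M S.zero)).ShortExact := by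
  rw [shortExact_iff] at hS ⊢
  intro x
  obtain ⟨h1, h2, h3⟩ := hS (SingleObj.star G)
  exact ⟨Module.Flat.lTensor_preserves_injective_linearMap _ h1, lTensor_exact _ h2 h3,
    LinearMap.lTensor_surjective _ h3⟩

/-- The endomorphism `[N] ↦ [M ⊗ N]` of `G₀(RG)`. -/
noncomputable def tensorG0 (M : RightMod R (SingleObj G)) :
    G0 (RightMod R (SingleObj G)) →+ G0 (RightMod R (SingleObj G)) :=
  G0.lift (fun N => G0.mk (tensor M N)) fun _ hS => G0.mk_shortExact (tensor_shortExact M hS)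

theorem tensorG0_mk (M N : RightMod R (SingleObj G)) :
    tensorG0 M (G0.mk N) = G0.mk (tensor M N) :=
  G0.lift_mk _ _ N

/-- A bijective equivariant linear map gives an isomorphism of right `RG`-modules. -/
noncomputable def isoMk {M N : RightMod R (SingleObj G)} (e : carrier M ≃ₗ[R] carrier N)
    (h : ∀ (g : G) v, e (rho M g v) = rho N g (e v)) : M ≅ N :=
  let f : M ⟶ N := homMk (fun _ => e.toLinearMap) fun {_ _} (g : G) v => h g v
  have : Mono f := (mono_iff f).2 fun _ => e.injective
  have : Epi f := (epi_iff f).2 fun _ => e.surjective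
  have := isIso_of_mono_of_epi f
  asIso f

/-- The trivial module is a unit for the tensor product. -/
noncomputable def tensorTrivialIso (M : RightMod R (SingleObj G)) :
    tensor M (trivial R (SingleObj G)) ≅ M :=
  isoMk (TensorProduct.rid R (carrier M)) fun g v => by
    refine LinearMap.congr_fun
      (f := (TensorProduct.rid R (carrier M)).toLinearMap ∘ₗ TensorProduct.map (rho M g) LinearMap.id)
      (g := rho M g ∘ₗ (TensorProduct.rid R (carrier M)).toLinearMap)
      (TensorProduct.ext' fun m n => ?_) v
    simp

/-- The right `RG`-module `Hom_R(M, N)`, with `(φ · g)(m) = φ(m · g⁻¹) · g`; as a functor of `N` it is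
right adjoint to `M ⊗ -`. -/
noncomputable def ihom (M N : RightMod R (SingleObj G)) : RightMod R (SingleObj G) :=
  mk (fun _ => carrier M →ₗ[R] carrier N)
    (fun {_ _} (g : G) => LinearMap.lcomp R (carrier N) (rho M g⁻¹) ∘ₗ
      LinearMap.compRight R (M := carrier M) (rho N g))
    (fun _ (φ : carrier M →ₗ[R] carrier N) => LinearMap.ext fun m => by
      change rho N 1 (φ (rho M 1⁻¹ m)) = φ m
      rw [inv_one, rho_one, rho_one])
    (fun {_ _ _} (h g : G) (φ : carrier M →ₗ[R] carrier N) => LinearMap.ext fun m => by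
      change rho N (g * h) (φ (rho M (g * h)⁻¹ m)) = rho N h (rho N g (φ (rho M g⁻¹ (rho M h⁻¹ m))))
      rw [mul_inv_rev, rho_mul, rho_mul])

/-- Functoriality of `Hom_R(M, -)`. -/
noncomputable def ihomMap (M : RightMod R (SingleObj G)) {N N' : RightMod R (SingleObj G)}
    (e : N ⟶ N') : ihom M N ⟶ ihom M N' :=
  homMk (fun _ => LinearMap.compRight R (M := carrier M) (app e (SingleObj.star G)))
    fun {_ _} (g : G) (φ : carrier M →ₗ[R] carrier N) => LinearMap.ext fun m =>
      app_act (x := SingleObj.star G) (y := SingleObj.star G) e g (φ (rho M g⁻¹ m))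

/-- Tensoring a projective module with any module gives a projective module. -/
theorem projective_tensor (M Q : RightMod R (SingleObj G)) [Projective Q] :
    Projective (tensor M Q) := by
  refine ⟨fun {N N'} f e he => ?_⟩
  have hepi : Epi (ihomMap M e) := by
    rw [epi_iff] at he ⊢
    intro _ (φ : carrier M →ₗ[R] carrier N')
    obtain ⟨ψ, hψ⟩ := Module.projective_lifting_property (app e (SingleObj.star G)) φ
      (he (SingleObj.star G))
    exact ⟨ψ, hψ⟩
  let f' : carrier M ⊗[R] carrier Q →ₗ[R] carrier N' := app f (SingleObj.star G)
  have hf' : ∀ (g : G) m q, f' (rho M g m ⊗ₜ[R] rho Q g q) = rho N' g (f' (m ⊗ₜ[R] q)) :=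
    fun g m q => app_act (x := SingleObj.star G) (y := SingleObj.star G) f g (m ⊗ₜ[R] q)
  let fhat : Q ⟶ ihom M N' := homMk (fun _ => (TensorProduct.curry f').flip)
    fun {_ _} (g : G) q => LinearMap.ext fun m => by
      change f' (m ⊗ₜ[R] rho Q g q) = rho N' g (f' (rho M g⁻¹ m ⊗ₜ[R] q))
      rw [← hf', rho_rho_inv]
  let k : Q ⟶ ihom M N := Projective.factorThru fhat (ihomMap M e)
  have hk : k ≫ ihomMap M e = fhat := Projective.factorThru_comp _ _
  let k' : carrier Q →ₗ[R] carrier M →ₗ[R] carrier N := app k (SingleObj.star G)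
  have hk1 : ∀ q m, app e (SingleObj.star G) (k' q m) = f' (m ⊗ₜ[R] q) := fun q m =>
    LinearMap.congr_fun (f := (app e (SingleObj.star G)) ∘ₗ k' q)
      (g := (TensorProduct.curry f').flip q) congr(app $hk (SingleObj.star G) q) m
  have hk2 : ∀ (g : G) q m, k' (rho Q g q) m = rho N g (k' q (rho M g⁻¹ m)) := fun g q m =>
    LinearMap.congr_fun (f := k' (rho Q g q)) (g := rho N g ∘ₗ k' q ∘ₗ rho M g⁻¹)
      (app_act (x := SingleObj.star G) (y := SingleObj.star G) k g q) m
  refine ⟨homMk (fun _ => TensorProduct.lift k'.flip) fun {_ _} (g : G) v => ?_,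
    hom_ext fun _ v => ?_⟩
  · refine LinearMap.congr_fun
      (f := TensorProduct.lift k'.flip ∘ₗ TensorProduct.map (rho M g) (rho Q g))
      (g := rho N g ∘ₗ TensorProduct.lift k'.flip) (TensorProduct.ext' fun m q => ?_) v
    change k' (rho Q g q) (rho M g m) = rho N g (k' q m)
    rw [hk2, rho_inv_rho]
  · refine LinearMap.congr_fun (f := app e (SingleObj.star G) ∘ₗ TensorProduct.lift k'.flip)
      (g := f') (TensorProduct.ext' fun m q => ?_) v
    exact hk1 q m

end Tensor

variable {R : Type u} [Field R] {G P : Type u} [Group G] [PartialOrder P]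
  [MulAction G P] [CovariantClass G P HSMul.hSMul LE.le] [Finite P]

/-! ### The composite of restriction and homology -/

open Classical in
/-- `M ⊗ C_n(P; R) ≅ C_n(P; κ_M)`, sending `m ⊗ f` to the family `(f_σ m)_σ`. -/
noncomputable def tensorChainsIso (M : RightMod R (SingleObj G)) (n : ℕ) :
    tensor M ((trivial R (TransporterCat G P)).chains n) ≅ ((res R G P).obj M).chains n :=
  isoMk (TensorProduct.piScalarRight R R (carrier M) (Chain P n)) fun g v => by
    refine LinearMap.congr_fun
      (f := (TensorProduct.piScalarRight R R (carrier M) (Chain P n)).toLinearMap ∘ₗ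
        TensorProduct.map (rho M g) (rho ((trivial R (TransporterCat G P)).chains n) g))
      (g := rho (((res R G P).obj M).chains n) g ∘ₗ
        (TensorProduct.piScalarRight R R (carrier M) (Chain P n)).toLinearMap)
      (TensorProduct.ext' fun m f => ?_) v
    refine funext fun σ : Chain P n => ?_
    exact (map_smul (rho M g) (show R from f (g • σ)) m).symm

/-- `lk_π ∘ r_π` is multiplication by the class of the homology representation of `P`. -/
theorem lk_r_mk (M : RightMod R (SingleObj G)) :
    lk R G P (r R G P (G0.mk M)) =
      tensorG0 M (trivial R (TransporterCat G P)).homologyClass := by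
  rw [r_mk, lk_mk, homologyClass_eq, homologyClass_eq, map_sum]
  refine Finset.sum_congr rfl fun i _ => ?_
  rw [map_zsmul, tensorG0_mk, G0.mk_iso (tensorChainsIso M i)]

theorem chainComplex_d_app (F : RightMod R (TransporterCat G P)) (n : ℕ) (x : SingleObj G) :
    app (F.chainComplex.d (n + 1) n) x = F.boundary n := by
  let d (n : ℕ) : F.chains (n + 1) ⟶ F.chains n :=
    homMk (fun _ => F.boundary n) fun {_ _} g f => F.boundary_act n g f
  have h : F.chainComplex.d (n + 1) n = d n := ChainComplex.of_d F.chains d n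
  rw [h]
  rfl

/-! ### Homology in degree zero of a connected poset -/

/-- The chain with the single element `p`. -/
def vertex (p : P) : Chain P 0 := ⟨fun _ => p, Subsingleton.strictMono (α := Fin 1) _⟩

theorem vertex_last (σ : Chain P 0) : vertex σ.last = σ :=
  Chain.ext (funext fun _ => congrArg σ.pts (Subsingleton.elim (α := Fin 1) _ _))

/-- The chain `p < q`. -/
def edge {p q : P} (h : p < q) : Chain P 1 where
  pts := ![p, q]
  strictMono := by
    rw [Fin.strictMono_iff_lt_succ]
    intro i
    fin_cases i
    exact h

theorem edge_face_zero {p q : P} (h : p < q) : (edge h).face 0 = vertex q := by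
  ext i
  fin_cases i
  rfl

theorem edge_face_one {p q : P} (h : p < q) : (edge h).face 1 = vertex p := by
  ext i
  fin_cases i
  rfl

variable (R G P) in
/-- The augmentation `C_0(P; R) → R`, the sum of the coefficients. -/
noncomputable def augmentation :
    (trivial R (TransporterCat G P)).chains 0 ⟶ trivial R (SingleObj G) :=
  homMk (fun _ => (∑ σ : Chain P 0, LinearMap.proj σ : (Chain P 0 → R) →ₗ[R] R))
    fun {_ _} (g : G) (f : Chain P 0 → R) => by
      change (∑ σ : Chain P 0, LinearMap.proj σ : (Chain P 0 → R) →ₗ[R] R) (fun σ => f (g • σ)) =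
        (∑ σ : Chain P 0, LinearMap.proj σ : (Chain P 0 → R) →ₗ[R] R) f
      simp only [LinearMap.sum_apply, LinearMap.proj_apply]
      exact Fintype.sum_equiv (MulAction.toPerm g : Equiv.Perm (Chain P 0)) _ _ fun _ => rfl

theorem augmentation_apply (x : SingleObj G) (f : Chain P 0 → R) :
    app (augmentation R G P) x f = (∑ σ, f σ : R) := by
  change (∑ σ : Chain P 0, LinearMap.proj σ : (Chain P 0 → R) →ₗ[R] R) f = _
  simp

variable (R G P) in
/-- The differential `C_1(P; R) → C_0(P; R)` as a map between spaces of functions. -/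
noncomputable abbrev boundaryZero : (Chain P 1 → R) →ₗ[R] Chain P 0 → R :=
  (trivial R (TransporterCat G P)).boundary 0

open Classical in
theorem boundaryZero_single (σ : Chain P 1) (c : R) :
    boundaryZero R G P (Pi.single σ c) =
      Pi.single (σ.face 0) c - Pi.single (σ.face 1) c := by
  refine ((trivial R (TransporterCat G P)).boundary_single 0 σ c).trans ?_
  rw [Fin.sum_univ_two, sub_eq_add_neg]
  congr 1
  · refine Eq.trans ?_ (one_smul R (Pi.single (σ.face 0) c : Chain P 0 → R))
    exact congrArg (fun a : R => a • (Pi.single (σ.face 0) c : Chain P 0 → R)) (pow_zero (-1))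
  · refine Eq.trans ?_ (neg_one_smul R (Pi.single (σ.face 1) c : Chain P 0 → R))
    exact congrArg (fun a : R => a • (Pi.single (σ.face 1) c : Chain P 0 → R)) (pow_one (-1))

open Classical in
/-- In a connected poset any two vertices are homologous: `b - a` is the boundary of the edge `a < b`,
and connectedness joins arbitrary vertices by a zigzag of comparable ones. -/
theorem single_sub_single_mem_range [IsConnected P] (p q : P) :
    (Pi.single (vertex p) 1 - Pi.single (vertex q) 1 : Chain P 0 → R) ∈
      LinearMap.range (boundaryZero R G P) := by
  have hle : ∀ {a b : P}, a ≤ b → (Pi.single (vertex b) 1 - Pi.single (vertex a) 1 : Chain P 0 → R) ∈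
      LinearMap.range (boundaryZero R G P) := by
    intro a b h
    rcases h.eq_or_lt with rfl | h
    · rw [sub_self]
      exact zero_mem _
    · refine ⟨Pi.single (edge h) 1, ?_⟩
      rw [boundaryZero_single, edge_face_zero, edge_face_one]
  refine induct_on_objects {p : P | (Pi.single (vertex p) 1 - Pi.single (vertex q) 1 : Chain P 0 → R) ∈
    LinearMap.range (boundaryZero R G P)} (j₀ := q) ?_ (fun {a b} f => ?_) p
  · rw [Set.mem_ofPred_eq, sub_self]
    exact zero_mem _
  have h := hle (leOfHom f)
  refine ⟨fun ha => ?_, fun hb => ?_⟩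
  · simpa using add_mem h ha
  · simpa using sub_mem hb h

theorem exact_augmentation [IsConnected P] (x : SingleObj G) :
    Function.Exact (boundaryZero R G P) (app (augmentation R G P) x) := by
  classical
  intro (f : Chain P 0 → R)
  rw [augmentation_apply]
  refine ⟨fun (h : (∑ σ, f σ : R) = 0) => ?_, ?_⟩
  · obtain ⟨q⟩ := IsConnected.is_nonempty (J := P)
    -- As the coefficients of `f` sum to zero, `f` is a combination of differences with a fixed `q`.
    have hf : f = ∑ σ, f σ • (Pi.single (vertex σ.last) 1 - Pi.single (vertex q) 1) := by
      simp only [smul_sub, Finset.sum_sub_distrib, ← Finset.sum_smul, vertex_last]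
      rw [h, zero_smul, sub_zero]
      exact pi_eq_sum_univ' f |>.trans (Finset.sum_congr rfl fun σ _ => by congr 1)
    have : f ∈ LinearMap.range (boundaryZero R G P) := by
      rw [hf]
      exact sum_mem fun σ _ => Submodule.smul_mem _ _ (single_sub_single_mem_range _ q)
    exact this
  · rintro ⟨w, rfl⟩
    have hw : w = ∑ σ, Pi.single σ (w σ) := (Finset.univ_sum_single w).symm
    rw [hw, map_sum]
    simp only [Finset.sum_apply]
    rw [Finset.sum_comm]
    refine Finset.sum_eq_zero (M := R) fun σ _ => ?_
    rw [boundaryZero_single]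
    simp [Finset.sum_sub_distrib]

variable (R G P) in
/-- For connected `P` the augmentation induces an isomorphism `H_0(P; R) ≅ R`. -/
noncomputable def homologyZeroIso [IsConnected P] :
    (trivial R (TransporterCat G P)).homology 0 ≅ trivial R (SingleObj G) :=
  let K := (trivial R (TransporterCat G P)).chainComplex
  have hd : ∀ x, app (K.d 1 0) x = boundaryZero R G P := chainComplex_d_app _ 0
  have hw : K.d 1 0 ≫ augmentation R G P = 0 := hom_ext fun x v =>
    (exact_augmentation x _).2 ⟨v, (LinearMap.congr_fun (hd x) v).symm⟩
  let S : ShortComplex (RightMod R (SingleObj G)) := ShortComplex.mk (K.d 1 0) (augmentation R G P) hw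
  have hS : S.Exact := (exact_iff S).2 fun x => by
    change Function.Exact (app (K.d 1 0) x) _
    rw [hd]
    exact exact_augmentation x
  have : Epi S.g := (epi_iff _).2 fun x (c : R) => by
    classical
    obtain ⟨q⟩ := IsConnected.is_nonempty (J := P)
    exact ⟨(Pi.single (vertex q) c : Chain P 0 → R), (augmentation_apply x _).trans (by simp; rfl)⟩
  K.isoHomologyι₀ ≪≫ (K.opcyclesIsCokernel 1 0 (by simp)).coconePointUniqueUpToIso hS.gIsCokernel

/-- `H_0` lies in the range of summation of `homologyClass` only because `P` is nonempty. -/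
theorem homologyClass_trivial [IsConnected P] (h : VanishingHomology R G P) :
    (trivial R (TransporterCat G P)).homologyClass = G0.mk (trivial R (SingleObj G)) := by
  have hP : 0 < Nat.card P := Nat.card_pos_iff.2 ⟨IsConnected.is_nonempty, inferInstance⟩
  rw [homologyClass, Finset.sum_eq_single_of_mem 0 (Finset.mem_range.2 hP)]
  · rw [pow_zero, one_smul, G0.mk_iso (homologyZeroIso R G P)]
  · intro i _ hi
    rw [G0.mk_isZero (h i (Nat.pos_of_ne_zero hi)), smul_zero]

/-! ### Restriction has a left inverse -/

theorem leftInverse_lk_r [IsConnected P] (h : VanishingHomology R G P) :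
    Function.LeftInverse (lk R G P) (r R G P) := by
  refine DFunLike.congr_fun (f := (lk R G P).comp (r R G P)) (g := AddMonoidHom.id _)
    (G0.hom_ext fun M => (lk_r_mk M).trans ?_)
  rw [homologyClass_trivial h, tensorG0_mk]
  exact G0.mk_iso (tensorTrivialIso M)

/-- If `lk_π ∘ r_π` is the identity modulo classes of projectives, then `lk'_π ∘ r'_π` is the
identity. -/
theorem leftInverse_lkSt_rSt (h : ∀ M : RightMod R (SingleObj G),
      lk R G P (r R G P (G0.mk M)) - G0.mk M ∈ G0.projClasses (RightMod R (SingleObj G))) :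
    Function.LeftInverse (lkSt R G P) (rSt R G P) := by
  refine DFunLike.congr_fun (f := (lkSt R G P).comp (rSt R G P)) (g := AddMonoidHom.id _)
    (QuotientAddGroup.addMonoidHom_ext _ (G0.hom_ext fun M => ?_))
  exact QuotientAddGroup.eq_iff_sub_mem.2 (h M)

theorem lk_r_sub_mem_of_isVirtualProjective (h : G0.IsVirtualProjective (steinberg R G P))
    (M : RightMod R (SingleObj G)) :
    lk R G P (r R G P (G0.mk M)) - G0.mk M ∈ G0.projClasses (RightMod R (SingleObj G)) := by
  obtain ⟨Q, Q', hQ, hQ', h⟩ := h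
  have hM : G0.mk M = tensorG0 M (G0.mk (trivial R (SingleObj G))) := by
    rw [tensorG0_mk, G0.mk_iso (tensorTrivialIso M)]
  rw [lk_r_mk, hM, ← map_sub, ← steinberg, h, map_sub, tensorG0_mk, tensorG0_mk]
  exact sub_mem (AddSubgroup.subset_closure ⟨_, projective_tensor M Q, rfl⟩)
    (AddSubgroup.subset_closure ⟨_, projective_tensor M Q', rfl⟩)

end RightMod

end GPoset

theorem corollary5p5 {R : Type u} [Field R] {G P : Type u} [Group G] [Finite G]
    [PartialOrder P] [Finite P] [MulAction G P] [CovariantClass G P HSMul.hSMul LE.le] :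
    (CategoryTheory.IsConnected P → GPoset.RightMod.VanishingHomology R G P →
      Function.Injective (GPoset.RightMod.r R G P) ∧
      Function.Injective (GPoset.RightMod.rSt R G P) ∧
      Function.Surjective (GPoset.RightMod.lk R G P) ∧
      Function.Surjective (GPoset.RightMod.lkSt R G P)) ∧
    (GPoset.G0.IsVirtualProjective (GPoset.RightMod.steinberg R G P) →
      Function.Injective (GPoset.RightMod.rSt R G P) ∧
      Function.Surjective (GPoset.RightMod.lkSt R G P)) := by
  refine ⟨fun hP h => ?_, fun h => ?_⟩
  · have h1 := GPoset.RightMod.leftInverse_lk_r (G := G) h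
    have h2 := GPoset.RightMod.leftInverse_lkSt_rSt (R := R) (G := G) (P := P) fun M => by
      rw [h1, sub_self]
      exact zero_mem _
    exact ⟨h1.injective, h2.injective, h1.surjective, h2.surjective⟩
  · have h2 := GPoset.RightMod.leftInverse_lkSt_rSt
      (GPoset.RightMod.lk_r_sub_mem_of_isVirtualProjective h)
    exact ⟨h2.injective, h2.surjective⟩
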